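/- For positive integers $\chi,\Delta$, a $(\chi,\Delta)$-coloring of a graph $G=(V,E)$ is a function $c:V\to\{1,\dots,\chi\}$ such that for every color $i$ the subgraph induced by $c^{-1}(i)$ has maximum degree at most $\Delta$. Defective Coloring is the problem of deciding, given $G,\chi,\Delta$, whether $G$ admits a $(\chi,\Delta)$-coloring. Theorem. There is an algorithm (a single program for a random access machine with unit cost per operation, whose arithmetic operations are addition and truncated subtraction) and an absolute constant $C$ such that the following holds. Given positive integers $\chi,\Delta$, a finite graph $G$ with $n$ vertices, and any tree decomposition of $G$ with $N$ nodes and width $\mathrm{tw}$ (the graph, the tree and the bags being given by $0$-$1$ matrices), the algorithm correctly decides whether $G$ admits a $(\chi,\Delta)$-coloring, and it halts after at most $$C\,(\chi\Delta)^{C\,\mathrm{tw}}\,(n+N)^{C}$$ steps. In particular, if the supplied tree decomposition has $N=n^{O(1)}$ nodes (and $n\ge 2$), then Defective Coloring is solved in time $(\chi\Delta)^{O(\mathrm{tw})}\,n^{O(1)}$. Here the width is the maximum size of a bag minus one, read as $0$ if all bags are empty. -/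

import Mathlib

/-! ### Tree decompositions -/

/-- A tree decomposition of `G` whose tree has node type `ι`. -/
structure TreeDecomposition {V : Type*} (G : SimpleGraph V) (ι : Type*) where
  /-- the decomposition tree -/
  tree : SimpleGraph ι
  isTree : tree.IsTree
  /-- the bag of a node -/
  bag : ι → Finset V
  exists_mem_bag : ∀ v : V, ∃ t, v ∈ bag t
  exists_edge_bag : ∀ u v : V, G.Adj u v → ∃ t, u ∈ bag t ∧ v ∈ bag t
  /-- the nodes whose bags contain a given vertex induce a subtree -/
  connected_nodes : ∀ v : V, (tree.induce {t | v ∈ bag t}).Connected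

/-- The maximum size of a bag minus one (read as `0` if all bags are empty). -/
def TreeDecomposition.width {V ι : Type*} [Fintype ι] {G : SimpleGraph V}
    (D : TreeDecomposition G ι) : ℕ :=
  (Finset.univ.sup fun t => (D.bag t).card) - 1

/-! ### Defective colorings -/

open Classical in
/-- `c` is a `(χ, Δ)`-coloring of `G`: every color class induces a subgraph of maximum degree
at most `Δ`. -/
def IsDefectiveColoring {V : Type*} [Fintype V] (G : SimpleGraph V) (χ Δ : ℕ)
    (c : V → Fin χ) : Prop :=
  ∀ i : Fin χ, (G.induce (c ⁻¹' {i})).maxDegree ≤ Δ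

/-- `G` admits a `(χ, Δ)`-coloring. -/
def HasDefectiveColoring {V : Type*} [Fintype V] (G : SimpleGraph V) (χ Δ : ℕ) : Prop :=
  ∃ c : V → Fin χ, IsDefectiveColoring G χ Δ c

/-! ### Random access machines

A unit-cost RAM over the natural numbers whose only arithmetic is addition and truncated
subtraction. Programs are written with structured control flow, which is a special case of jumps.
A program mentions finitely many registers; the memory is reached by indirect addressing. -/

namespace RAM

/-- The contents of the registers and of the memory cells. -/
structure State where
  reg : ℕ → ℕ
  mem : ℕ → ℕ

/-- Programs; `x y z` are (indices of) registers. -/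
inductive Program where
  /-- do nothing -/
  | skip
  /-- `x := k` for a fixed number `k` -/
  | const (x k : ℕ)
  /-- `x := y + z` -/
  | add (x y z : ℕ)
  /-- `x := max (y - z) 0` -/
  | sub (x y z : ℕ)
  /-- `x := mem[y]` -/
  | load (x y : ℕ)
  /-- `mem[x] := y` -/
  | store (x y : ℕ)
  /-- first `p`, then `q` -/
  | seq (p q : Program)
  /-- if `x ≠ 0` then `p` else `q` -/
  | cond (x : ℕ) (p q : Program)
  /-- while `x ≠ 0` do `p` -/
  | loop (x : ℕ) (p : Program)

/-- Assign the value `a` to register `x`. -/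
def State.setReg (s : State) (x a : ℕ) : State :=
  { s with reg := Function.update s.reg x a }

/-- Write the value `a` into the memory cell with address `i`. -/
def State.setMem (s : State) (i a : ℕ) : State :=
  { s with mem := Function.update s.mem i a }

/-- `Runs p s t s'`: started in state `s`, the program `p` halts after exactly `t` steps, in
state `s'`. Every elementary instruction and every test of a register is one step. -/
inductive Runs : Program → State → ℕ → State → Prop
  | skip (s : State) : Runs .skip s 1 s
  | const (s : State) (x k : ℕ) : Runs (.const x k) s 1 (s.setReg x k)
  | add (s : State) (x y z : ℕ) : Runs (.add x y z) s 1 (s.setReg x (s.reg y + s.reg z))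
  | sub (s : State) (x y z : ℕ) : Runs (.sub x y z) s 1 (s.setReg x (s.reg y - s.reg z))
  | load (s : State) (x y : ℕ) : Runs (.load x y) s 1 (s.setReg x (s.mem (s.reg y)))
  | store (s : State) (x y : ℕ) : Runs (.store x y) s 1 (s.setMem (s.reg x) (s.reg y))
  | seq {p q : Program} {s₀ s₁ s₂ : State} {t₁ t₂ : ℕ} :
      Runs p s₀ t₁ s₁ → Runs q s₁ t₂ s₂ → Runs (.seq p q) s₀ (t₁ + t₂) s₂
  | cond_true {x : ℕ} {p q : Program} {s s' : State} {t : ℕ} :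
      s.reg x ≠ 0 → Runs p s t s' → Runs (.cond x p q) s (t + 1) s'
  | cond_false {x : ℕ} {p q : Program} {s s' : State} {t : ℕ} :
      s.reg x = 0 → Runs q s t s' → Runs (.cond x p q) s (t + 1) s'
  | loop_done {x : ℕ} {p : Program} {s : State} :
      s.reg x = 0 → Runs (.loop x p) s 1 s
  | loop_step {x : ℕ} {p : Program} {s₀ s₁ s₂ : State} {t₁ t₂ : ℕ} :
      s₀.reg x ≠ 0 → Runs p s₀ t₁ s₁ → Runs (.loop x p) s₁ t₂ s₂ →
        Runs (.loop x p) s₀ (t₁ + t₂ + 1) s₂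

/-- The initial state: the input is stored in the memory cells `0, 1, 2, …`; all other cells and
all registers are `0`. -/
def initState (input : List ℕ) : State where
  reg := fun _ => 0
  mem := fun i => input.getD i 0

end RAM

/-! ### The input -/

open Classical in
/-- The `0`-`1` matrix of a relation, row by row. -/
noncomputable def encodeRel {a b : ℕ} (R : Fin a → Fin b → Prop) : List ℕ :=
  (List.finRange a).flatMap fun i => (List.finRange b).map fun j => if R i j then 1 else 0

/-- The input: the numbers `χ`, `Δ`, the number of vertices, the number of nodes, followed by the
adjacency matrix of the graph, the adjacency matrix of the decomposition tree, and the node-vertex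
incidence matrix of the bags. -/
noncomputable def encodeInstance {n N : ℕ} (G : SimpleGraph (Fin n))
    (D : TreeDecomposition G (Fin N)) (χ Δ : ℕ) : List ℕ :=
  [χ, Δ, n, N] ++ encodeRel G.Adj ++ encodeRel D.tree.Adj ++ encodeRel fun t v => v ∈ D.bag t

/-! The algorithm eliminates the nodes of the decomposition tree leaf by leaf. A state of a bag
gives each of its vertices a color and a degree, and is coded by a number written in base `base`.
Every monochromatic edge is charged to the first node whose bag contains both ends, and the initial
table of a node admits the states whose degrees count exactly the edges charged there. A defective
coloring then amounts to one admitted state per node, with agreeing colors, such that the degrees at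
every vertex add up to at most Δ (`extendable_range_iff`).

A leaf `s` is merged into its neighbour `t` by matching colors and adding degrees on the common
vertices. This loses nothing, because a vertex of the bag of `s` that occurs in another remaining
bag also occurs in that of `t` (`leaf_neighbour_mem`, `extendable_erase_iff`). After `N - 1` merges
a single node remains, and a coloring exists iff its table admits a state (`exists_alive`,
`answer_eq`).

Allowing more than n + 1 colors or degrees above n is useless, so the base is at most (n + 1)²; for
χ ≥ 2 it is also at most (χΔ)². Charging one vertex of a bag to the first bound and the remaining
ones to the second gives at most (n + 1)² (χΔ)^(2 tw) states (`numCodes_le`). For χ = 1 the degrees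
are tested directly: χΔ may then be 1, while a base Δ + 1 would be at least 2.

On the machine, every loop runs for the number M of rounds kept in register 0. The functions
computable in time polynomial in M (`Comp`) are closed under arithmetic, memory reads, folds and
bounded quantifiers, so that writing a table entry as a formula already yields a program for it. M
is raised in stages to (n + N + 2)² times the number of states; then M cells from address M on are
filled in order, each from the cells before it (`exists_fill`, `entry_fillMem`). -/

namespace RAM

/-! ### Total correctness with time bounds -/

/-- Started in `s`, the program `p` halts after at most `T` steps in a state satisfying `Q`. -/
def Reaches (p : Program) (s : State) (T : ℕ) (Q : State → Prop) : Prop :=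
  ∃ t s', Runs p s t s' ∧ t ≤ T ∧ Q s'

@[simp] theorem State.setReg_reg (s : State) (x a j : ℕ) :
    (s.setReg x a).reg j = if j = x then a else s.reg j := by
  simp [State.setReg, Function.update_apply]

@[simp] theorem State.setReg_mem (s : State) (x a : ℕ) : (s.setReg x a).mem = s.mem := rfl

@[simp] theorem State.setMem_reg (s : State) (i a : ℕ) : (s.setMem i a).reg = s.reg := rfl

@[simp] theorem State.setMem_mem (s : State) (i a : ℕ) :
    (s.setMem i a).mem = Function.update s.mem i a := rfl

namespace Reaches

variable {p q : Program} {s : State} {T T' : ℕ} {Q R : State → Prop}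

theorem mono (h : Reaches p s T Q) (hT : T ≤ T') (hQ : ∀ s', Q s' → R s') :
    Reaches p s T' R := by
  obtain ⟨t, s', h1, h2, h3⟩ := h
  exact ⟨t, s', h1, h2.trans hT, hQ _ h3⟩

theorem seq (h : Reaches p s T Q) (h' : ∀ s', Q s' → Reaches q s' T' R) :
    Reaches (.seq p q) s (T + T') R := by
  obtain ⟨t, s', h1, h2, h3⟩ := h
  obtain ⟨t', s'', h1', h2', h3'⟩ := h' s' h3
  exact ⟨_, _, .seq h1 h1', by omega, h3'⟩

theorem const {x k : ℕ} (h : Q (s.setReg x k)) : Reaches (.const x k) s 1 Q :=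
  ⟨_, _, .const s x k, le_rfl, h⟩

theorem add {x y z : ℕ} (h : Q (s.setReg x (s.reg y + s.reg z))) :
    Reaches (.add x y z) s 1 Q :=
  ⟨_, _, .add s x y z, le_rfl, h⟩

theorem sub {x y z : ℕ} (h : Q (s.setReg x (s.reg y - s.reg z))) :
    Reaches (.sub x y z) s 1 Q :=
  ⟨_, _, .sub s x y z, le_rfl, h⟩

theorem load {x y : ℕ} (h : Q (s.setReg x (s.mem (s.reg y)))) :
    Reaches (.load x y) s 1 Q :=
  ⟨_, _, .load s x y, le_rfl, h⟩

theorem store {x y : ℕ} (h : Q (s.setMem (s.reg x) (s.reg y))) :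
    Reaches (.store x y) s 1 Q :=
  ⟨_, _, .store s x y, le_rfl, h⟩

theorem cond {x : ℕ} (h1 : s.reg x ≠ 0 → Reaches p s T Q) (h2 : s.reg x = 0 → Reaches q s T Q) :
    Reaches (.cond x p q) s (T + 1) Q := by
  by_cases h : s.reg x = 0
  · obtain ⟨t, s', h1, h2, h3⟩ := h2 h
    exact ⟨_, _, .cond_false h h1, by omega, h3⟩
  · obtain ⟨t, s', h1, h2, h3⟩ := h1 h
    exact ⟨_, _, .cond_true h h1, by omega, h3⟩

/-- A loop with a counter: `I i` is the invariant after `i` of `M` rounds. -/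
theorem forLoop {x M : ℕ} {I : ℕ → State → Prop}
    (hx : ∀ i ≤ M, ∀ s, I i s → s.reg x = M - i)
    (hstep : ∀ i < M, ∀ s, I i s → Reaches p s T (I (i + 1))) (h0 : I 0 s) :
    Reaches (.loop x p) s (M * (T + 1) + 1) (I M) := by
  have key : ∀ c i s, i + c = M → I i s → Reaches (.loop x p) s (c * (T + 1) + 1) (I M) := by
    intro c
    induction c with
    | zero =>
      intro i s hi hI
      obtain rfl : i = M := by omega
      exact ⟨1, s, .loop_done (by simp [hx i le_rfl s hI]), by omega, hI⟩
    | succ c ih =>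
      intro i s hi hI
      obtain ⟨t, s', h1, h2, h3⟩ := hstep i (by omega) s hI
      obtain ⟨t', s'', h1', h2', h3'⟩ := ih (i + 1) s' (by omega) h3
      refine ⟨_, _, .loop_step ?_ h1 h1', ?_, h3'⟩
      · rw [hx i (by omega) s hI]; omega
      · rw [Nat.succ_mul]; omega
  exact key M 0 s (by omega) h0

end Reaches

/-! ### Computable functions with polynomially many steps

The register `0` holds the number of rounds of every loop. -/

/-- A type of environments: a tuple of numbers which are kept in registers, a memory, and the
number of rounds of every loop. -/
class Ctx (α : Type) where
  /-- where the numbers of the environment are stored -/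
  Layout : Type
  /-- only registers below a given one are used -/
  Below : Layout → ℕ → Prop
  /-- the state represents the environment -/
  Rep : Layout → α → State → Prop
  /-- the number of rounds of every loop -/
  bound : α → ℕ
  /-- the memory -/
  mem : α → ℕ → ℕ
  below_mono : ∀ {l d d'}, Below l d → d ≤ d' → Below l d'
  below_pos : ∀ {l d}, Below l d → 0 < d
  rep_bound : ∀ {l a s}, Rep l a s → s.reg 0 = bound a
  rep_mem : ∀ {l a s}, Rep l a s → s.mem = mem a
  rep_congr : ∀ {l a s s' d}, Below l d → Rep l a s → (∀ j < d, s'.reg j = s.reg j) →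
    s'.mem = s.mem → Rep l a s'

/-- Environments without registers: the number of rounds of a loop, and the memory. -/
abbrev Env := ℕ × (ℕ → ℕ)

instance : Ctx Env where
  Layout := Unit
  Below _ d := 0 < d
  Rep _ a s := s.reg 0 = a.1 ∧ s.mem = a.2
  bound a := a.1
  mem a := a.2
  below_mono := fun h h' => h.trans_le h'
  below_pos := id
  rep_bound := fun h => h.1
  rep_mem := fun h => h.2
  rep_congr := fun hd h h1 h2 => ⟨(h1 0 hd).trans h.1, h2.trans h.2⟩

instance {α : Type} [Ctx α] : Ctx (α × ℕ) where
  Layout := Ctx.Layout α × ℕ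
  Below l d := Ctx.Below l.1 d ∧ l.2 < d
  Rep l a s := Ctx.Rep l.1 a.1 s ∧ s.reg l.2 = a.2
  bound a := Ctx.bound a.1
  mem a := Ctx.mem a.1
  below_mono := fun h h' => ⟨Ctx.below_mono h.1 h', h.2.trans_le h'⟩
  below_pos := fun h => Ctx.below_pos h.1
  rep_bound := fun h => Ctx.rep_bound h.1
  rep_mem := fun h => Ctx.rep_mem h.1
  rep_congr := fun hd h h1 h2 => ⟨Ctx.rep_congr hd.1 h.1 h1 h2, (h1 _ hd.2).trans h.2⟩

/-- The state `s'` arises from `s` by changing only registers from `d` on. -/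
def Agree (d : ℕ) (s s' : State) : Prop := (∀ j < d, s'.reg j = s.reg j) ∧ s'.mem = s.mem

theorem Agree.trans {d : ℕ} {s s' s'' : State} (h : Agree d s s') (h' : Agree d s' s'') :
    Agree d s s'' :=
  ⟨fun j hj => (h'.1 j hj).trans (h.1 j hj), h'.2.trans h.2⟩

theorem Agree.mono {d d' : ℕ} {s s' : State} (h : Agree d' s s') (hd : d ≤ d') : Agree d s s' :=
  ⟨fun j hj => h.1 j (hj.trans_le hd), h.2⟩

theorem Agree.setReg {d x : ℕ} (s : State) (a : ℕ) (hx : d ≤ x) : Agree d s (s.setReg x a) :=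
  ⟨fun j hj => by simp [show j ≠ x by omega], rfl⟩

theorem Agree.rep {α : Type} [Ctx α] {d : ℕ} {s s' : State} {l : Ctx.Layout α} {a : α}
    (h : Agree d s s') (hd : Ctx.Below l d) (hr : Ctx.Rep l a s) : Ctx.Rep l a s' :=
  Ctx.rep_congr hd hr h.1 h.2

/-- The function `f` is computed by a program whose number of steps is polynomial in the number of
rounds of a loop. -/
def Comp {α : Type} [Ctx α] (f : α → ℕ) : Prop :=
  ∀ (l : Ctx.Layout α) (d : ℕ), Ctx.Below l d → ∃ (p : Program) (K : ℕ), ∀ a s, Ctx.Rep l a s →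
    Reaches p s (K * (Ctx.bound a + 1) ^ K) fun s' => s'.reg d = f a ∧ Agree d s s'

/-- Bounds of the form `K * (M + 1) ^ K` absorb sequencing and a loop of M rounds, so a single
constant describes a polynomial running time. -/
theorem exists_poly_bound (K₁ K₂ c : ℕ) : ∃ K, ∀ M : ℕ,
    K₁ * (M + 1) ^ K₁ + (K₂ * (M + 1) ^ K₂ + c) ≤ K * (M + 1) ^ K ∧
      K₁ * (M + 1) ^ K₁ + (M + 1) * (K₂ * (M + 1) ^ K₂ + c) ≤ K * (M + 1) ^ K := by
  suffices h : ∃ K, ∀ M : ℕ,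
      K₁ * (M + 1) ^ K₁ + (M + 1) * (K₂ * (M + 1) ^ K₂ + c) ≤ K * (M + 1) ^ K by
    obtain ⟨K, h⟩ := h
    refine ⟨K, fun M => ⟨le_trans ?_ (h M), h M⟩⟩
    exact Nat.add_le_add_left (Nat.le_mul_of_pos_left _ (by omega)) _
  refine ⟨K₁ + K₂ + c + 1, fun M => ?_⟩
  have h1 : (M + 1) ^ K₁ ≤ (M + 1) ^ (K₁ + K₂ + c + 1) :=
    Nat.pow_le_pow_right (by omega) (by omega)
  have h2 : (M + 1) ^ (K₂ + 1) ≤ (M + 1) ^ (K₁ + K₂ + c + 1) :=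
    Nat.pow_le_pow_right (by omega) (by omega)
  have h3 : (M + 1) ^ 1 ≤ (M + 1) ^ (K₁ + K₂ + c + 1) :=
    Nat.pow_le_pow_right (by omega) (by omega)
  rw [pow_succ] at h2
  have h1' := Nat.mul_le_mul_left K₁ h1
  have h2' := Nat.mul_le_mul_left K₂ h2
  have h3' := Nat.mul_le_mul_left c h3
  nlinarith

namespace Comp

variable {α : Type} [Ctx α] {f g : α → ℕ}

theorem const (k : ℕ) : Comp fun _ : α => k := by
  intro l d hd
  refine ⟨.const d k, 1, fun a s hs => (Reaches.const ?_).mono ?_ fun _ h => h⟩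
  · exact ⟨by simp, Agree.setReg _ _ le_rfl⟩
  · simp

theorem register {l : Ctx.Layout α} {d x : ℕ} (hxd : x < d)
    (hx : ∀ a s, Ctx.Rep l a s → s.reg x = f a) :
    ∃ (p : Program) (K : ℕ), ∀ a s, Ctx.Rep l a s →
      Reaches p s (K * (Ctx.bound a + 1) ^ K) fun s' => s'.reg d = f a ∧ Agree d s s' := by
  refine ⟨.seq (.const d 0) (.add d d x), 2, fun a s hs =>
    (Reaches.seq (Q := fun s' => s' = s.setReg d 0) (Reaches.const rfl) fun s' hs' =>
      Reaches.add ?_).mono ?_ fun _ h => h⟩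
  · subst hs'
    refine ⟨by simp [show x ≠ d by omega, hx a s hs], ?_⟩
    exact (Agree.setReg _ _ le_rfl).trans (Agree.setReg _ _ le_rfl)
  · have : 1 ≤ (Ctx.bound a + 1) ^ 2 := Nat.one_le_pow _ _ (by omega)
    omega

theorem bound : Comp fun a : α => Ctx.bound a := fun _ _ hd =>
  register (Ctx.below_pos hd) fun _ _ h => Ctx.rep_bound h

theorem snd : Comp fun p : α × ℕ => p.2 := fun l _ hd =>
  register (x := l.2) hd.2 fun _ _ h => h.2

theorem weaken (hf : Comp f) : Comp fun p : α × ℕ => f p.1 := fun l d hd => by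
  obtain ⟨p, K, h⟩ := hf l.1 d hd.1
  exact ⟨p, K, fun a s hs => h a.1 s hs.1⟩

/-- Stack discipline: the first value waits in register `d` while the second is evaluated with `d +
1` as first free register. -/
theorem binary (hf : Comp f) (hg : Comp g) {op : ℕ → ℕ → ℕ} {P : ℕ → Program}
    (hP : ∀ d s Q, Q (s.setReg d (op (s.reg d) (s.reg (d + 1)))) → Reaches (P d) s 1 Q) :
    Comp fun a => op (f a) (g a) := by
  intro l d hd
  obtain ⟨p, K, h⟩ := hf l d hd
  have hd' := Ctx.below_mono hd (Nat.le_succ d)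
  obtain ⟨q, K', h'⟩ := hg l (d + 1) hd'
  obtain ⟨K₀, hK₀⟩ := exists_poly_bound K K' 1
  refine ⟨.seq p (.seq q (P d)), K₀, fun a s hs => ((h a s hs).seq fun s' hs' =>
    (h' a s' (hs'.2.rep hd hs)).seq fun s'' hs'' => hP _ _ _ ?_).mono
      (hK₀ _).1 fun _ h => h⟩
  refine ⟨?_, (hs'.2.trans (hs''.2.mono (by omega))).trans (Agree.setReg _ _ le_rfl)⟩
  simp [hs''.1, hs''.2.1 d (by omega), hs'.1]

theorem add (hf : Comp f) (hg : Comp g) : Comp fun a => f a + g a :=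
  binary hf hg (P := fun d => .add d d (d + 1)) fun _ _ _ h => Reaches.add h

theorem sub (hf : Comp f) (hg : Comp g) : Comp fun a => f a - g a :=
  binary hf hg (P := fun d => .sub d d (d + 1)) fun _ _ _ h => Reaches.sub h

theorem mem (hf : Comp f) : Comp fun a => Ctx.mem a (f a) := by
  intro l d hd
  obtain ⟨p, K, h⟩ := hf l d hd
  obtain ⟨K₀, hK₀⟩ := exists_poly_bound K 0 1
  refine ⟨.seq p (.load d d), K₀, fun a s hs => ((h a s hs).seq fun s' hs' =>
    Reaches.load ?_).mono (le_trans ?_ (hK₀ _).1) fun _ h => h⟩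
  · exact ⟨by simp [hs'.1, Ctx.rep_mem (hs'.2.rep hd hs)],
      hs'.2.trans (Agree.setReg _ _ le_rfl)⟩
  · omega

theorem ite_ne_zero {c : α → ℕ} (hc : Comp c) (hf : Comp f) (hg : Comp g) :
    Comp fun a => if c a ≠ 0 then f a else g a := by
  intro l d hd
  obtain ⟨p, K, h⟩ := hc l d hd
  obtain ⟨p₁, K₁, h₁⟩ := hf l d hd
  obtain ⟨p₂, K₂, h₂⟩ := hg l d hd
  obtain ⟨K', hK'⟩ := exists_poly_bound K₁ K₂ 1
  obtain ⟨K₀, hK₀⟩ := exists_poly_bound K K' 1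
  refine ⟨.seq p (.cond d p₁ p₂), K₀, fun a s hs => ((h a s hs).seq fun s' hs' =>
    Reaches.cond (T := K' * (Ctx.bound a + 1) ^ K') (fun hne => ?_) fun he => ?_).mono
      (hK₀ _).1 fun _ h => h⟩
  · refine (h₁ a s' (hs'.2.rep hd hs)).mono (le_trans ?_ (hK' _).1) fun s'' hs'' => ?_
    · omega
    · rw [hs'.1] at hne
      exact ⟨by simp [hs''.1, hne], hs'.2.trans hs''.2⟩
  · refine (h₂ a s' (hs'.2.rep hd hs)).mono (le_trans ?_ (hK' _).1) fun s'' hs'' => ?_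
    · omega
    · rw [hs'.1] at he
      exact ⟨by simp [hs''.1, he], hs'.2.trans hs''.2⟩

/-- The result of a loop which updates a number. -/
def foldValue (M x : ℕ) (step : ℕ → ℕ → ℕ) : ℕ := Nat.rec x step M

/-- Register `d` holds the accumulator, `d + 1` the round index, `d + 2` the countdown; the body
works from `d + 3` on and sees index and accumulator as two extra variables of its environment. -/
theorem fold {step : α → ℕ → ℕ → ℕ} (hf : Comp f)
    (hs : Comp fun p : (α × ℕ) × ℕ => step p.1.1 p.1.2 p.2) :
    Comp fun a => foldValue (Ctx.bound a) (f a) (step a) := by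
  intro l d hd
  obtain ⟨p, K, h⟩ := hf l d hd
  have hd1 := Ctx.below_mono hd (show d ≤ d + 3 by omega)
  obtain ⟨q, K', h'⟩ := hs ((l, d + 1), d) (d + 3) ⟨⟨hd1, by simp⟩, by simp⟩
  obtain ⟨K₀, hK₀⟩ := exists_poly_bound K K' 10
  refine ⟨.seq p (.seq (.const (d + 1) 0) (.seq (.const (d + 2) 0) (.seq (.add (d + 2) (d + 2) 0)
    (.loop (d + 2) (.seq q (.seq (.const d 0) (.seq (.add d d (d + 3)) (.seq (.const (d + 3) 1)
      (.seq (.add (d + 1) (d + 1) (d + 3)) (.sub (d + 2) (d + 2) (d + 3))))))))))), K₀,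
    fun a s hs => ?_⟩
  have hd0 := Ctx.below_pos hd
  let I : ℕ → State → Prop := fun i s' => s'.reg (d + 2) = Ctx.bound a - i ∧ s'.reg (d + 1) = i ∧
    s'.reg d = foldValue i (f a) (step a) ∧ Agree d s s'
  refine Reaches.mono (T := K * (Ctx.bound a + 1) ^ K + (1 + (1 + (1 +
    (Ctx.bound a * (K' * (Ctx.bound a + 1) ^ K' + 5 + 1) + 1)))))
    (Q := I (Ctx.bound a)) ?_ ?_ ?_
  · refine (h a s hs).seq fun s₁ h₁ => (Reaches.const (Q := fun s₂ => s₂ = s₁.setReg (d + 1) 0)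
      rfl).seq fun s₂ h₂ => (Reaches.const (Q := fun s₃ => s₃ = s₂.setReg (d + 2) 0)
      rfl).seq fun s₃ h₃ => (Reaches.add (Q := I 0) ?_).seq fun s₄ h₄ =>
      Reaches.forLoop (I := I) (fun i hi s' hs' => hs'.1) ?_ h₄
    · subst h₃ h₂
      refine ⟨?_, by simp, by simp [h₁.1, foldValue], ?_⟩
      · simp [Ctx.rep_bound (h₁.2.rep hd hs)]
      · exact ((h₁.2.trans (Agree.setReg _ _ (by omega))).trans
          (Agree.setReg _ _ (by omega))).trans (Agree.setReg _ _ (by omega))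
    · intro i hi s₁ h₁
      refine Reaches.seq (h' ((a, i), s₁.reg d) s₁ ⟨⟨h₁.2.2.2.rep hd hs, h₁.2.1⟩, rfl⟩)
        fun s₂ h₂ => ?_
      refine ((Reaches.const (Q := fun s₃ => s₃ = s₂.setReg d 0) rfl).seq fun s₃ h₃ =>
        (Reaches.add (Q := fun s₄ => s₄ = s₃.setReg d (s₃.reg d + s₃.reg (d + 3)))
        rfl).seq fun s₄ h₄ =>
        (Reaches.const (Q := fun s₅ => s₅ = s₄.setReg (d + 3) 1) rfl).seq fun s₅ h₅ =>
        (Reaches.add (Q := fun s₆ => s₆ = s₅.setReg (d + 1)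
        (s₅.reg (d + 1) + s₅.reg (d + 3))) rfl).seq fun s₆ h₆ =>
        Reaches.sub (Q := I (i + 1)) ?_).mono (by omega) fun _ h => h
      have e1 := h₂.2.1 (d + 1) (by omega)
      have e2 := h₂.2.1 (d + 2) (by omega)
      subst h₆ h₅ h₄ h₃
      refine ⟨?_, ?_, ?_, ?_⟩
      · simp [e2, h₁.1]; omega
      · simp [e1, h₁.2.1]
      · simp [h₂.1, h₁.2.2.1, foldValue]
      · exact ((((((h₁.2.2.2.trans (h₂.2.mono (by omega))).trans (Agree.setReg _ _ (by omega))).trans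
          (Agree.setReg _ _ (by omega))).trans (Agree.setReg _ _ (by omega))).trans
          (Agree.setReg _ _ (by omega))).trans (Agree.setReg _ _ (by omega)))
  · refine le_trans ?_ (hK₀ _).2
    generalize K' * (Ctx.bound a + 1) ^ K' = x
    nlinarith
  · exact fun s' hs' => ⟨hs'.2.2.1, hs'.2.2.2⟩

theorem sum {f : α → ℕ → ℕ} (hf : Comp fun p : α × ℕ => f p.1 p.2) :
    Comp fun a => ∑ i ∈ Finset.range (Ctx.bound a), f a i := by
  have h := fold (step := fun a i x => x + f a i) (const (α := α) 0) (snd.add hf.weaken)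
  have e : ∀ a n, foldValue n 0 (fun i x => x + f a i) = ∑ i ∈ Finset.range n, f a i := by
    intro a n
    induction n with
    | zero => rfl
    | succ n ih => rw [Finset.sum_range_succ, ← ih]; rfl
  simpa only [e] using h

end Comp

/-! ### Decidable predicates -/

open Classical in
/-- The predicate `p` is decided by a program whose number of steps is polynomial in the number of
rounds of a loop. -/
def CompP {α : Type} [Ctx α] (p : α → Prop) : Prop := Comp fun a => if p a then 1 else 0

theorem Comp.ite {α : Type} [Ctx α] {p : α → Prop} [DecidablePred p] {f g : α → ℕ}
    (hp : CompP p) (hf : Comp f) (hg : Comp g) : Comp fun a => if p a then f a else g a := by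
  have h := Comp.ite_ne_zero hp hf hg
  convert h using 3 with a
  by_cases h : p a <;> simp [h]

namespace CompP

variable {α : Type} [Ctx α] {p q : α → Prop} {f g : α → ℕ}

theorem of_ne_zero (hf : Comp f) : CompP fun a => f a ≠ 0 := by
  have h := Comp.ite_ne_zero hf (Comp.const 1) (Comp.const 0)
  unfold CompP
  convert h using 3

theorem congr (hp : CompP p) (h : ∀ a, q a ↔ p a) : CompP q := by
  rwa [show q = p from funext fun a => propext (h a)]

theorem not (hp : CompP p) : CompP fun a => ¬ p a := by
  classical
  refine (of_ne_zero (Comp.ite hp (Comp.const 0) (Comp.const 1))).congr fun a => ?_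
  by_cases h : p a <;> simp [h]

theorem and (hp : CompP p) (hq : CompP q) : CompP fun a => p a ∧ q a := by
  classical
  refine (of_ne_zero (Comp.ite hp hq (Comp.const 0))).congr fun a => ?_
  by_cases h : p a <;> simp [h]

theorem imp (hp : CompP p) (hq : CompP q) : CompP fun a => p a → q a := by
  classical
  refine (of_ne_zero (Comp.ite hp hq (Comp.const 1))).congr fun a => ?_
  by_cases h : p a <;> simp [h]

theorem lt (hf : Comp f) (hg : Comp g) : CompP fun a => f a < g a :=
  (of_ne_zero (hg.sub hf)).congr fun a => by omega

theorem le (hf : Comp f) (hg : Comp g) : CompP fun a => f a ≤ g a :=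
  (lt hg hf).not.congr fun a => by omega

theorem eq (hf : Comp f) (hg : Comp g) : CompP fun a => f a = g a :=
  ((le hf hg).and (le hg hf)).congr fun a => by omega

/-- A bounded existential quantifier is a sum of indicators that does not vanish. -/
theorem ex {p : α → ℕ → Prop} (hp : CompP fun x : α × ℕ => p x.1 x.2) :
    CompP fun a => ∃ i < Ctx.bound a, p a i := by
  classical
  refine (of_ne_zero (Comp.sum (f := fun a i => if p a i then 1 else 0)
    (Comp.ite hp (Comp.const 1) (Comp.const 0)))).congr fun a => ?_
  simp

theorem all {p : α → ℕ → Prop} (hp : CompP fun x : α × ℕ => p x.1 x.2) :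
    CompP fun a => ∀ i < Ctx.bound a, p a i :=
  (ex (p := fun a i => ¬ p a i) hp.not).not.congr fun a => by push Not; rfl

end CompP

/-! ### Arithmetic -/

/-- Multiplication, if `b ≤ M`. -/
def bmul (M a b : ℕ) : ℕ := ∑ i ∈ Finset.range M, if i < b then a else 0

/-- Division, if `a ≤ M` and `0 < b`. -/
def bdiv (M a b : ℕ) : ℕ := ∑ i ∈ Finset.range M, if bmul M b (i + 1) ≤ a then 1 else 0

/-- The remainder of a division, if `a ≤ M` and `0 < b`. -/
def bmod (M a b : ℕ) : ℕ := a - bmul M b (bdiv M a b)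

/-- Exponentiation, if `b ≤ M` and `e ≤ M`. -/
def bpow (M b e : ℕ) : ℕ := Comp.foldValue M 1 fun i x => if i < e then bmul M x b else x

theorem bmul_eq {M a b : ℕ} (h : b ≤ M) : bmul M a b = a * b := by
  have : (Finset.range M).filter (· < b) = Finset.range b := by
    ext i; simp; omega
  rw [bmul, ← Finset.sum_filter, this]
  simp [mul_comm]

theorem bdiv_eq {M a b : ℕ} (h : a ≤ M) (hb : 0 < b) : bdiv M a b = a / b := by
  have : (Finset.range M).filter (fun i => bmul M b (i + 1) ≤ a) = Finset.range (a / b) := by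
    ext i
    simp only [Finset.mem_filter, Finset.mem_range]
    have h1 : a / b ≤ a := Nat.div_le_self a b
    have h2 : i < a / b ↔ b * (i + 1) ≤ a := by
      rw [← Nat.succ_le_iff, Nat.le_div_iff_mul_le hb, mul_comm]
    constructor
    · rintro ⟨h3, h4⟩
      rw [bmul_eq (by omega)] at h4
      exact h2.2 h4
    · intro h3
      have h4 : i < M := by omega
      exact ⟨h4, by rw [bmul_eq (by omega)]; exact h2.1 h3⟩
  rw [bdiv, ← Finset.sum_filter, this]
  simp

theorem bmod_eq {M a b : ℕ} (h : a ≤ M) (hb : 0 < b) : bmod M a b = a % b := by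
  have h1 : a / b ≤ a := Nat.div_le_self a b
  rw [bmod, bdiv_eq h hb, bmul_eq (by omega), Nat.mod_eq_sub_mul_div]

/-- Only the second factor of `bmul` must be at most `M`, so the power itself may exceed the number
of rounds. -/
theorem bpow_eq {M b e : ℕ} (h : b ≤ M) (he : e ≤ M) : bpow M b e = b ^ e := by
  have : ∀ k, Comp.foldValue k 1 (fun i x => if i < e then bmul M x b else x) = b ^ min k e := by
    intro k
    induction k with
    | zero => simp [Comp.foldValue]
    | succ k ih =>
      rw [Comp.foldValue] at ih ⊢
      simp only [ih]
      split_ifs with hk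
      · rw [bmul_eq h, min_eq_left (by omega), min_eq_left (by omega), pow_succ]
      · rw [min_eq_right (by omega), min_eq_right (by omega)]
  rw [bpow, this, min_eq_right he]

namespace Comp

variable {α : Type} [Ctx α] {f g : α → ℕ}

theorem bmul (hf : Comp f) (hg : Comp g) : Comp fun a => bmul (Ctx.bound a) (f a) (g a) :=
  sum (f := fun a i => if i < g a then f a else 0) (ite (.lt snd hg.weaken) hf.weaken (const 0))

theorem bdiv (hf : Comp f) (hg : Comp g) : Comp fun a => bdiv (Ctx.bound a) (f a) (g a) :=
  sum (f := fun a i => if RAM.bmul (Ctx.bound a) (g a) (i + 1) ≤ f a then 1 else 0)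
    (ite (.le (bmul (α := α × ℕ) hg.weaken (snd.add (const 1))) hf.weaken) (const 1) (const 0))

theorem bmod (hf : Comp f) (hg : Comp g) : Comp fun a => bmod (Ctx.bound a) (f a) (g a) :=
  hf.sub (hg.bmul (hf.bdiv hg))

theorem bpow (hf : Comp f) (hg : Comp g) : Comp fun a => bpow (Ctx.bound a) (f a) (g a) :=
  fold (step := fun a i x => if i < g a then RAM.bmul (Ctx.bound a) x (f a) else x) (const 1)
    (ite (.lt snd.weaken hg.weaken.weaken) (bmul (α := (α × ℕ) × ℕ) snd hf.weaken.weaken) snd)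

end Comp

end RAM

namespace RAM

/-! ### Assigning the number of rounds, and filling an array -/

/-- Lets the number of rounds grow between phases; the cost is measured by its old value. -/
theorem exists_setBound {f : Env → ℕ} (hf : Comp f) : ∃ (p : Program) (K : ℕ), ∀ s : State,
    Reaches p s (K * (s.reg 0 + 1) ^ K) fun s' => s'.reg 0 = f (s.reg 0, s.mem) ∧
      s'.mem = s.mem := by
  obtain ⟨p, K, h⟩ := hf () 1 one_pos
  obtain ⟨K₀, hK₀⟩ := exists_poly_bound K 0 2
  refine ⟨.seq p (.seq (.const 2 0) (.add 0 1 2)), K₀, fun s =>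
    ((h (s.reg 0, s.mem) s ⟨rfl, rfl⟩).seq fun s' hs' =>
    (Reaches.const (Q := fun s'' => s'' = s'.setReg 2 0) rfl).seq fun s'' hs'' =>
    Reaches.add ?_).mono (le_trans ?_ (hK₀ _).1) fun _ h => h⟩
  · subst hs''
    simp [hs'.1, hs'.2.2]
  · simp only [Ctx.bound]
    omega

/-- The memory after `i` rounds of writing the values of `f` into the cells `M, M + 1, …`. -/
def fillMem (M : ℕ) (f : (ℕ → ℕ) → ℕ → ℕ) (m : ℕ → ℕ) : ℕ → ℕ → ℕ
  | 0 => m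
  | i + 1 => Function.update (fillMem M f m i) (M + i) (f (fillMem M f m i) i)

theorem fillMem_of_lt {M : ℕ} {f : (ℕ → ℕ) → ℕ → ℕ} {m : ℕ → ℕ} {i j : ℕ} (hj : j < M) :
    fillMem M f m i j = m j := by
  induction i with
  | zero => rfl
  | succ i ih => rw [fillMem, Function.update_of_ne (by omega), ih]

/-- Later rounds write to other cells, so a cell keeps the value computed from the memory of its own
round. This is what turns filling into recursion on the index. -/
theorem fillMem_of_le {M : ℕ} {f : (ℕ → ℕ) → ℕ → ℕ} {m : ℕ → ℕ} {i k j : ℕ} (hj : j < i)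
    (hk : i ≤ k) : fillMem M f m k (M + j) = f (fillMem M f m j) j := by
  induction k, hk using Nat.le_induction with
  | base =>
    induction i with
    | zero => omega
    | succ i ih =>
      by_cases h : j = i
      · subst h; simp [fillMem]
      · rw [fillMem, Function.update_of_ne (by omega), ih (by omega)]
  | succ k hk ih => rw [fillMem, Function.update_of_ne (by omega), ih]

/-- Registers: 1 is the index, 2 the countdown, 3 the value, 4 the address. -/
theorem exists_fill {f : ℕ → (ℕ → ℕ) → ℕ → ℕ}
    (hf : Comp fun p : Env × ℕ => f p.1.1 p.1.2 p.2) : ∃ (p : Program) (K : ℕ), ∀ s : State,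
    Reaches p s (K * (s.reg 0 + 1) ^ K) fun s' => s'.reg 0 = s.reg 0 ∧
      s'.mem = fillMem (s.reg 0) (f (s.reg 0)) s.mem (s.reg 0) := by
  obtain ⟨p, K, h⟩ := hf ((), 1) 3 ⟨by simp [Ctx.Below], by simp⟩
  obtain ⟨K₀, hK₀⟩ := exists_poly_bound 0 K 10
  refine ⟨.seq (.const 1 0) (.seq (.const 2 0) (.seq (.add 2 2 0)
    (.loop 2 (.seq p (.seq (.add 4 0 1) (.seq (.store 4 3) (.seq (.const 3 1)
      (.seq (.add 1 1 3) (.sub 2 2 3))))))))), K₀, fun s => ?_⟩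
  let I : ℕ → State → Prop := fun i s' => s'.reg 2 = s.reg 0 - i ∧ s'.reg 1 = i ∧
    s'.reg 0 = s.reg 0 ∧ s'.mem = fillMem (s.reg 0) (f (s.reg 0)) s.mem i
  refine Reaches.mono (T := 1 + (1 + (1 +
    (s.reg 0 * (K * (s.reg 0 + 1) ^ K + 5 + 1) + 1)))) (Q := I (s.reg 0)) ?_ ?_
    fun s' hs' => hs'.2.2
  · refine (Reaches.const (Q := fun s₁ => s₁ = s.setReg 1 0) rfl).seq fun s₁ h₁ =>
      (Reaches.const (Q := fun s₂ => s₂ = s₁.setReg 2 0) rfl).seq fun s₂ h₂ =>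
      (Reaches.add (Q := I 0) ?_).seq fun s₃ h₃ =>
      Reaches.forLoop (I := I) (fun i hi s' hs' => hs'.1) ?_ h₃
    · subst h₂ h₁
      exact ⟨by simp, by simp, by simp, by simp [fillMem]⟩
    · intro i hi s₁ h₁
      refine Reaches.seq (h ((s.reg 0, fillMem (s.reg 0) (f (s.reg 0)) s.mem i), i) s₁
        ⟨h₁.2.2, h₁.2.1⟩) fun s₂ h₂ => ?_
      refine ((Reaches.add (Q := fun s₃ => s₃ = s₂.setReg 4 (s₂.reg 0 + s₂.reg 1))
        rfl).seq fun s₃ h₃ =>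
        (Reaches.store (Q := fun s₄ => s₄ = s₃.setMem (s₃.reg 4) (s₃.reg 3)) rfl).seq
        fun s₄ h₄ =>
        (Reaches.const (Q := fun s₅ => s₅ = s₄.setReg 3 1) rfl).seq fun s₅ h₅ =>
        (Reaches.add (Q := fun s₆ => s₆ = s₅.setReg 1 (s₅.reg 1 + s₅.reg 3)) rfl).seq
        fun s₆ h₆ => Reaches.sub (Q := I (i + 1)) ?_).mono (by omega) fun _ h => h
      have e0 := h₂.2.1 0 (by omega)
      have e1 := h₂.2.1 1 (by omega)
      have e2 := h₂.2.1 2 (by omega)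
      have e3 := h₂.2.2
      subst h₆ h₅ h₄ h₃
      refine ⟨?_, ?_, ?_, ?_⟩
      · simp [e2, h₁.1]; omega
      · simp [e1, h₁.2.1]
      · simp [e0, h₁.2.2.1]
      · simp [e0, e1, e3, h₁.2.1, h₁.2.2.1, h₁.2.2.2, h₂.1, fillMem]
  · refine le_trans ?_ (hK₀ _).2
    generalize K * (s.reg 0 + 1) ^ K = x
    nlinarith

end RAM

/-! ### The leaf-elimination dynamic program as formulas over the memory. -/

namespace RAM

/-! ### The algorithm -/

namespace Algo

/-- Adjacency of the vertices `u` and `v`. -/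
def IsAdj (M : ℕ) (m : ℕ → ℕ) (u v : ℕ) : Prop :=
  u < m 2 ∧ v < m 2 ∧ m (4 + (bmul M u (m 2) + v)) ≠ 0

/-- Adjacency of the nodes `s` and `t`. -/
def IsTree (M : ℕ) (m : ℕ → ℕ) (s t : ℕ) : Prop :=
  s < m 3 ∧ t < m 3 ∧ m (4 + bmul M (m 2) (m 2) + (bmul M s (m 3) + t)) ≠ 0

/-- The vertex `v` belongs to the bag of the node `t`. -/
def IsBag (M : ℕ) (m : ℕ → ℕ) (t v : ℕ) : Prop :=
  t < m 3 ∧ v < m 2 ∧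
    m (4 + bmul M (m 2) (m 2) + bmul M (m 3) (m 3) + (bmul M t (m 2) + v)) ≠ 0

open Classical in
/-- The maximum size of a bag. -/
noncomputable def maxBag (M : ℕ) (m : ℕ → ℕ) : ℕ := ∑ j ∈ Finset.range M,
  if ∃ t < M, j < ∑ v ∈ Finset.range M, if IsBag M m t v then 1 else 0 then 1 else 0

/-- The number of colors, truncated. -/
def colors (m : ℕ → ℕ) : ℕ := if m 0 < m 2 + 1 then m 0 else m 2 + 1

/-- The number of admissible degrees, truncated. -/
def degrees (m : ℕ → ℕ) : ℕ := (if m 1 < m 2 then m 1 else m 2) + 1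

/-- The number of pairs of a color and a degree. -/
noncomputable def base (M : ℕ) (m : ℕ → ℕ) : ℕ := if m 0 ≤ 1 then 1 else bmul M (colors m) (degrees m)

/-- The number of codes of the states of a bag. -/
noncomputable def numCodes (M : ℕ) (m : ℕ → ℕ) : ℕ := bpow M (base M m) (maxBag M m)

open Classical in
/-- The pair of a color and a degree which the code `x` gives to the vertex `v` of the bag of
the node `t`. -/
noncomputable def digit (M : ℕ) (m : ℕ → ℕ) (t x v : ℕ) : ℕ :=
  bmod M (bdiv M x (bpow M (base M m)
    (∑ u ∈ Finset.range M, if u < v ∧ IsBag M m t u then 1 else 0))) (base M m)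

/-- The color in the digit. -/
noncomputable def col (M : ℕ) (m : ℕ → ℕ) (t x v : ℕ) : ℕ := bdiv M (digit M m t x v) (degrees m)

/-- The degree in the digit. -/
noncomputable def deg (M : ℕ) (m : ℕ → ℕ) (t x v : ℕ) : ℕ := bmod M (digit M m t x v) (degrees m)

open Classical in
/-- The degrees of the code `x` count the monochromatic edges whose first node is `t`. -/
def InitOk (M : ℕ) (m : ℕ → ℕ) (t x : ℕ) : Prop := ∀ v < M, IsBag M m t v →
  deg M m t x v = ∑ u ∈ Finset.range M, if IsBag M m t u ∧ IsAdj M m u v ∧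
    col M m t x u = col M m t x v ∧ ∀ t' < M, t' < t → IsBag M m t' u → ¬ IsBag M m t' v
    then 1 else 0

/-- The node `s` has exactly one neighbour among the nodes which are alive in the table `T`. -/
def IsLeaf (M : ℕ) (m : ℕ → ℕ) (T : ℕ → ℕ → ℕ) (s : ℕ) : Prop :=
  T s 0 ≠ 2 ∧ ∃ t < M, (T t 0 ≠ 2 ∧ IsTree M m s t) ∧
    ∀ t' < M, T t' 0 ≠ 2 → IsTree M m s t' → t' = t

/-- The first leaf, which dies next. -/
def IsFirstLeaf (M : ℕ) (m : ℕ → ℕ) (T : ℕ → ℕ → ℕ) (s : ℕ) : Prop :=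
  IsLeaf M m T s ∧ ∀ s' < M, s' < s → ¬ IsLeaf M m T s'

open Classical in
/-- The code `x` combines the codes `p` of a state at `t` and `q` of a state at `s`. -/
def Fits (M : ℕ) (m : ℕ → ℕ) (t s p q x : ℕ) : Prop := ∀ v < M, IsBag M m t v →
  col M m t p v = col M m t x v ∧
  deg M m t x v = deg M m t p v + (if IsBag M m s v then deg M m s q v else 0) ∧
  (IsBag M m s v → col M m s q v = col M m t x v)

open Classical in
/-- The next table. -/
noncomputable def stepTable (M : ℕ) (m : ℕ → ℕ) (T : ℕ → ℕ → ℕ) (t x : ℕ) : ℕ :=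
  if T t 0 ≠ 2 → IsFirstLeaf M m T t then 2 else
  if ∃ s < M, IsFirstLeaf M m T s ∧ IsTree M m s t then
    if ∃ s < M, (IsFirstLeaf M m T s ∧ IsTree M m s t) ∧
      ∃ p < M, (p < numCodes M m ∧ T t p = 1) ∧
      ∃ q < M, (q < numCodes M m ∧ T s q = 1) ∧ Fits M m t s p q x then 1 else 0
  else T t x

open Classical in
/-- The first table. -/
noncomputable def initTable (M : ℕ) (m : ℕ → ℕ) (t x : ℕ) : ℕ := if InitOk M m t x then 1 else 0

/-- The table number `r`, read from the memory. -/
noncomputable def entry (M : ℕ) (m : ℕ → ℕ) (r t x : ℕ) : ℕ :=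
  if t < m 3 ∧ x < numCodes M m then
    m (M + (bmul M (bmul M r (m 3) + t) (numCodes M m) + x)) else 0

/-- The number which is written into the cell number `i` of the array. -/
noncomputable def cell (M : ℕ) (m : ℕ → ℕ) (i : ℕ) : ℕ :=
  if bdiv M (bdiv M i (numCodes M m)) (m 3) = 0 then
    initTable M m (bmod M (bdiv M i (numCodes M m)) (m 3)) (bmod M i (numCodes M m))
  else stepTable M m (entry M m (bdiv M (bdiv M i (numCodes M m)) (m 3) - 1))
    (bmod M (bdiv M i (numCodes M m)) (m 3)) (bmod M i (numCodes M m))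

open Classical in
/-- The answer, read from the memory. -/
noncomputable def answer (M : ℕ) (m : ℕ → ℕ) : ℕ :=
  if m 0 ≤ 1 then
    if ∀ v < M, (∑ u ∈ Finset.range M, if IsAdj M m u v then 1 else 0) ≤ m 1 then 1 else 0
  else if ∃ t < M, ∃ x < M, entry M m (m 3 - 1) t x = 1 then 1 else 0

/-! ### Polynomial-time computability of these formulas. -/

section Comp

variable {α : Type} [Ctx α] {e f g h k l : α → ℕ}

open RAM.Comp

local notation "M'" => Ctx.bound
local notation "m'" => Ctx.mem

theorem cell_const (j : ℕ) : Comp fun a : α => m' a j := mem (const j)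

theorem comp_isAdj (hf : Comp f) (hg : Comp g) :
    CompP fun a => IsAdj (M' a) (m' a) (f a) (g a) :=
  (CompP.lt hf (cell_const 2)).and ((CompP.lt hg (cell_const 2)).and
    (.of_ne_zero (mem ((const 4).add ((hf.bmul (cell_const 2)).add hg)))))

theorem comp_isTree (hf : Comp f) (hg : Comp g) :
    CompP fun a => IsTree (M' a) (m' a) (f a) (g a) :=
  (CompP.lt hf (cell_const 3)).and ((CompP.lt hg (cell_const 3)).and
    (.of_ne_zero (mem (((const 4).add ((cell_const 2).bmul (cell_const 2))).add
      ((hf.bmul (cell_const 3)).add hg)))))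

theorem comp_isBag (hf : Comp f) (hg : Comp g) :
    CompP fun a => IsBag (M' a) (m' a) (f a) (g a) :=
  (CompP.lt hf (cell_const 3)).and ((CompP.lt hg (cell_const 2)).and
    (.of_ne_zero (mem ((((const 4).add ((cell_const 2).bmul (cell_const 2))).add
      ((cell_const 3).bmul (cell_const 3))).add ((hf.bmul (cell_const 2)).add hg)))))

theorem comp_maxBag : Comp fun a : α => maxBag (M' a) (m' a) := by
  classical
  exact sum (f := fun (a : α) j => if ∃ t < M' a, j < ∑ v ∈ Finset.range (M' a),
      if IsBag (M' a) (m' a) t v then 1 else 0 then 1 else 0)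
    (ite (.ex (p := fun (p : α × ℕ) t => p.2 < ∑ v ∈ Finset.range (M' p),
      if IsBag (M' p) (m' p) t v then 1 else 0)
      (.lt snd.weaken (sum (f := fun (p : (α × ℕ) × ℕ) v =>
        if IsBag (M' p) (m' p) p.2 v then 1 else 0)
        (ite (comp_isBag (α := ((α × ℕ) × ℕ) × ℕ) snd.weaken snd) (const 1) (const 0)))))
      (const 1) (const 0))

theorem comp_colors : Comp fun a : α => colors (m' a) :=
  ite (.lt (cell_const 0) ((cell_const 2).add (const 1))) (cell_const 0)
    ((cell_const 2).add (const 1))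

theorem comp_degrees : Comp fun a : α => degrees (m' a) :=
  (ite (.lt (cell_const 1) (cell_const 2)) (cell_const 1) (cell_const 2)).add (const 1)

theorem comp_base : Comp fun a : α => base (M' a) (m' a) :=
  ite (.le (cell_const 0) (const 1)) (const 1) (comp_colors.bmul comp_degrees)

theorem comp_numCodes : Comp fun a : α => numCodes (M' a) (m' a) := comp_base.bpow comp_maxBag

theorem comp_digit (hf : Comp f) (hg : Comp g) (hh : Comp h) :
    Comp fun a => digit (M' a) (m' a) (f a) (g a) (h a) := by
  classical
  exact (hg.bdiv (comp_base.bpow (sum (f := fun (a : α) u =>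
    if u < h a ∧ IsBag (M' a) (m' a) (f a) u then 1 else 0)
    (ite ((CompP.lt snd hh.weaken).and (comp_isBag (α := α × ℕ) hf.weaken snd))
      (const 1) (const 0))))).bmod comp_base

theorem comp_col (hf : Comp f) (hg : Comp g) (hh : Comp h) :
    Comp fun a => col (M' a) (m' a) (f a) (g a) (h a) := (comp_digit hf hg hh).bdiv comp_degrees

theorem comp_deg (hf : Comp f) (hg : Comp g) (hh : Comp h) :
    Comp fun a => deg (M' a) (m' a) (f a) (g a) (h a) := (comp_digit hf hg hh).bmod comp_degrees

theorem comp_initOk (hf : Comp f) (hg : Comp g) :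
    CompP fun a => InitOk (M' a) (m' a) (f a) (g a) := by
  classical
  refine .all (p := fun (_ : α) _ => _ → _) (.imp (comp_isBag (α := α × ℕ) hf.weaken snd)
    (.eq (comp_deg (α := α × ℕ) hf.weaken hg.weaken snd)
      (sum (α := α × ℕ) (f := fun (a : α × ℕ) u => if IsBag (M' a) (m' a) (f a.1) u ∧
        IsAdj (M' a) (m' a) u a.2 ∧
        col (M' a) (m' a) (f a.1) (g a.1) u = col (M' a) (m' a) (f a.1) (g a.1) a.2 ∧
        ∀ t' < M' a, t' < f a.1 → IsBag (M' a) (m' a) t' u → ¬ IsBag (M' a) (m' a) t' a.2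
        then 1 else 0) (ite ?_ (const 1) (const 0)))))
  refine (comp_isBag (α := (α × ℕ) × ℕ) hf.weaken.weaken snd).and
    ((comp_isAdj (α := (α × ℕ) × ℕ) snd snd.weaken).and
    ((CompP.eq (comp_col (α := (α × ℕ) × ℕ) hf.weaken.weaken hg.weaken.weaken snd)
      (comp_col (α := (α × ℕ) × ℕ) hf.weaken.weaken hg.weaken.weaken snd.weaken)).and
    (.all (α := (α × ℕ) × ℕ) (p := fun (_ : (α × ℕ) × ℕ) _ => _ → _ → ¬ _)
    ((CompP.lt snd hf.weaken.weaken.weaken).imp ((comp_isBag (α := ((α × ℕ) × ℕ) × ℕ) snd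
      snd.weaken).imp (comp_isBag (α := ((α × ℕ) × ℕ) × ℕ) snd snd.weaken.weaken).not)))))

theorem comp_initTable (hf : Comp f) (hg : Comp g) :
    Comp fun a => initTable (M' a) (m' a) (f a) (g a) := by
  classical
  exact ite (comp_initOk hf hg) (const 1) (const 0)

theorem comp_entry (hf : Comp f) (hg : Comp g) (hh : Comp h) :
    Comp fun a => entry (M' a) (m' a) (f a) (g a) (h a) :=
  ite ((CompP.lt hg (cell_const 3)).and (.lt hh comp_numCodes))
    (mem (bound.add (((((hf.bmul (cell_const 3)).add hg)).bmul comp_numCodes).add hh))) (const 0)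

theorem comp_alive (hf : Comp f) (hg : Comp g) :
    CompP fun a => entry (M' a) (m' a) (f a) (g a) 0 ≠ 2 :=
  (CompP.eq (comp_entry hf hg (const 0)) (const 2)).not

theorem comp_isLeaf (hf : Comp f) (hg : Comp g) :
    CompP fun a => IsLeaf (M' a) (m' a) (entry (M' a) (m' a) (f a)) (g a) :=
  (comp_alive hf hg).and (.ex (p := fun (_ : α) _ => (_ ∧ _) ∧ _)
    (((comp_alive (α := α × ℕ) hf.weaken snd).and
      (comp_isTree (α := α × ℕ) hg.weaken snd)).and
    (.all (α := α × ℕ) (p := fun (_ : α × ℕ) _ => _ → _ → _ = _)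
      ((comp_alive (α := (α × ℕ) × ℕ) hf.weaken.weaken snd).imp
      ((comp_isTree (α := (α × ℕ) × ℕ) hg.weaken.weaken snd).imp (.eq snd snd.weaken))))))

theorem comp_isFirstLeaf (hf : Comp f) (hg : Comp g) :
    CompP fun a => IsFirstLeaf (M' a) (m' a) (entry (M' a) (m' a) (f a)) (g a) :=
  (comp_isLeaf hf hg).and (.all (p := fun (_ : α) _ => _ → ¬ _)
    ((CompP.lt snd hg.weaken).imp (comp_isLeaf (α := α × ℕ) hf.weaken snd).not))

theorem comp_fits (he : Comp e) (hf : Comp f) (hg : Comp g) (hh : Comp h) (hk : Comp k) :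
    CompP fun a => Fits (M' a) (m' a) (e a) (f a) (g a) (h a) (k a) := by
  classical
  exact .all (p := fun (_ : α) _ => _ → _ ∧ _ ∧ _)
    ((comp_isBag (α := α × ℕ) he.weaken snd).imp
    ((CompP.eq (comp_col (α := α × ℕ) he.weaken hg.weaken snd)
      (comp_col (α := α × ℕ) he.weaken hk.weaken snd)).and
    ((CompP.eq (comp_deg (α := α × ℕ) he.weaken hk.weaken snd)
      ((comp_deg (α := α × ℕ) he.weaken hg.weaken snd).add
      (ite (comp_isBag (α := α × ℕ) hf.weaken snd)
        (comp_deg (α := α × ℕ) hf.weaken hh.weaken snd) (const 0)))).and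
    ((comp_isBag (α := α × ℕ) hf.weaken snd).imp
      (.eq (comp_col (α := α × ℕ) hf.weaken hh.weaken snd)
      (comp_col (α := α × ℕ) he.weaken hk.weaken snd))))))

theorem comp_stepTable (hf : Comp f) (hg : Comp g) (hh : Comp h) :
    Comp fun a => stepTable (M' a) (m' a) (entry (M' a) (m' a) (f a)) (g a) (h a) := by
  classical
  refine ite ((comp_alive hf hg).imp (comp_isFirstLeaf hf hg)) (const 2)
    (ite (.ex (p := fun (_ : α) _ => _ ∧ _) ((comp_isFirstLeaf (α := α × ℕ) hf.weaken snd).and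
      (comp_isTree (α := α × ℕ) snd hg.weaken)))
    (ite (.ex (p := fun (_ : α) s => (_ ∧ _) ∧ _)
      (((comp_isFirstLeaf (α := α × ℕ) hf.weaken snd).and
      (comp_isTree (α := α × ℕ) snd hg.weaken)).and ?_)) (const 1) (const 0))
    (comp_entry hf hg hh))
  refine .ex (α := α × ℕ) (p := fun (a : α × ℕ) p => (_ ∧ _) ∧ _)
    (((CompP.lt snd (comp_numCodes (α := (α × ℕ) × ℕ))).and
    (.eq (comp_entry (α := (α × ℕ) × ℕ) hf.weaken.weaken hg.weaken.weaken snd) (const 1))).and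
    (.ex (α := (α × ℕ) × ℕ) (p := fun (a : (α × ℕ) × ℕ) p => (_ ∧ _) ∧ _)
    (((CompP.lt snd (comp_numCodes (α := ((α × ℕ) × ℕ) × ℕ))).and
    (.eq (comp_entry (α := ((α × ℕ) × ℕ) × ℕ) hf.weaken.weaken.weaken snd.weaken.weaken snd)
      (const 1))).and
    (comp_fits (α := ((α × ℕ) × ℕ) × ℕ) hg.weaken.weaken.weaken snd.weaken.weaken snd.weaken snd
      hh.weaken.weaken.weaken))))

theorem comp_cell (hf : Comp f) : Comp fun a => cell (M' a) (m' a) (f a) :=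
  have ht := (hf.bdiv comp_numCodes).bmod (cell_const 3)
  have hx := hf.bmod comp_numCodes
  have hr := (hf.bdiv comp_numCodes).bdiv (cell_const 3)
  ite (.eq hr (const 0)) (comp_initTable ht hx) (comp_stepTable (hr.sub (const 1)) ht hx)

theorem comp_answer : Comp fun a : α => answer (M' a) (m' a) := by
  classical
  exact ite (.le (cell_const 0) (const 1))
    (ite (.all (p := fun (a : α) _ => _ ≤ _)
      (.le (sum (α := α × ℕ) (f := fun (a : α × ℕ) u => if IsAdj (M' a) (m' a) u a.2 then 1 else 0)
        (ite (comp_isAdj (α := (α × ℕ) × ℕ) snd snd.weaken) (const 1) (const 0)))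
        (cell_const (α := α × ℕ) 1))) (const 1) (const 0))
    (ite (.ex (p := fun (_ : α) _ => _) (.ex (α := α × ℕ) (p := fun (_ : α × ℕ) _ => _ = _)
      (.eq (comp_entry (α := (α × ℕ) × ℕ) ((cell_const 3).sub (const 1)) snd.weaken snd)
      (const 1)))) (const 1) (const 0))

end Comp

end Algo

end RAM

/-! ### Dynamic programming over a tree decomposition, with indices in `ℕ` -/

namespace BagCodes

variable {bag adj : ℕ → ℕ → Prop} {col deg : ℕ → ℕ → ℕ → ℕ} {X Δ S n N : ℕ}

/-- The numbers below `S` encode, for every bag, all pairs of a coloring with colors below `X` and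
a function with values at most `Δ`. -/
structure IsCode (bag : ℕ → ℕ → Prop) (col deg : ℕ → ℕ → ℕ → ℕ) (X Δ S : ℕ) : Prop where
  col_lt : ∀ t x v, x < S → bag t v → col t x v < X
  deg_le : ∀ t x v, x < S → bag t v → deg t x v ≤ Δ
  exists_code : ∀ t (f g : ℕ → ℕ), (∀ v, bag t v → f v < X ∧ g v ≤ Δ) →
    ∃ x < S, ∀ v, bag t v → col t x v = f v ∧ deg t x v = g v

open Classical in
/-- One can choose codes in the tables of the nodes in `A` whose colorings agree and whose degrees
add up to at most `Δ` at every vertex. -/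
def Extendable (bag : ℕ → ℕ → Prop) (col deg : ℕ → ℕ → ℕ → ℕ) (Δ S : ℕ) (A : Finset ℕ)
    (T : ℕ → ℕ → Prop) : Prop :=
  ∃ c x : ℕ → ℕ, (∀ t ∈ A, x t < S ∧ T t (x t) ∧ ∀ v, bag t v → col t (x t) v = c v) ∧
    ∀ v, (∑ t ∈ A, if bag t v then deg t (x t) v else 0) ≤ Δ

open Classical in
/-- The code `x` combines the codes `p` of a state at `t` and `q` of a state at `s`. -/
def Combines (bag : ℕ → ℕ → Prop) (col deg : ℕ → ℕ → ℕ → ℕ) (t s p q x : ℕ) : Prop :=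
  ∀ v, bag t v → col t p v = col t x v ∧
    deg t x v = deg t p v + (if bag s v then deg s q v else 0) ∧
    (bag s v → col s q v = col t x v)

/-- Merging a leaf preserves solvability. By `hsep`, the vertices of the bag of `s` are either in
the bag of `t`, where `Combines` controls them, or in no other remaining bag. -/
theorem extendable_erase_iff (h : IsCode bag col deg X Δ S) {A : Finset ℕ} {s t : ℕ}
    {T T' : ℕ → ℕ → Prop} (hs : s ∈ A) (ht : t ∈ A) (hst : s ≠ t)
    (hsep : ∀ v, bag s v → ∀ u ∈ A, u ≠ s → bag u v → bag t v)
    (hT : ∀ u ∈ A, u ≠ s → u ≠ t → ∀ x < S, (T' u x ↔ T u x))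
    (hT' : ∀ x < S, T' t x ↔ ∃ p < S, T t p ∧ ∃ q < S, T s q ∧ Combines bag col deg t s p q x) :
    Extendable bag col deg Δ S (A.erase s) T' ↔ Extendable bag col deg Δ S A T := by
  classical
  have ht' : t ∈ A.erase s := Finset.mem_erase.2 ⟨hst.symm, ht⟩
  constructor
  · rintro ⟨c, x, h1, h2⟩
    obtain ⟨hx, hTx, hc⟩ := h1 t ht'
    obtain ⟨p, hp, hTp, q, hq, hTq, hf⟩ := (hT' _ hx).1 hTx
    let x' := Function.update (Function.update x t p) s q
    have xs : x' s = q := by simp [x']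
    have xt : x' t = p := by simp [x', hst.symm]
    have xu : ∀ u, u ≠ s → u ≠ t → x' u = x u := fun u h1 h2 => by simp [x', h1, h2]
    -- The coloring is overwritten on the bag of `s`; on vertices shared with other bags this
    -- changes nothing, since they lie in the bag of `t`.
    refine ⟨fun v => if bag s v then col s q v else c v, x', fun u hu => ?_, fun v => ?_⟩
    · by_cases hus : u = s
      · subst hus
        rw [xs]
        exact ⟨hq, hTq, fun v hv => by simp [hv]⟩
      have hcol : ∀ v, bag u v → (if bag s v then col s q v else c v) = c v := by
        intro v hv
        split_ifs with hsv
        · have htv := hsep v hsv u hu hus hv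
          rw [(hf v htv).2.2 hsv, hc v htv]
        · rfl
      by_cases hut : u = t
      · subst hut
        rw [xt]
        exact ⟨hp, hTp, fun v hv => ((hf v hv).1.trans (hc v hv)).trans (hcol v hv).symm⟩
      · rw [xu u hus hut]
        obtain ⟨hxu, hTu, hcu⟩ := h1 u (Finset.mem_erase.2 ⟨hus, hu⟩)
        exact ⟨hxu, (hT u hu hus hut _ hxu).1 hTu, fun v hv => (hcu v hv).trans (hcol v hv).symm⟩
    · have h3 := h2 v
      rw [← Finset.add_sum_erase _ _ ht'] at h3
      rw [← Finset.add_sum_erase _ _ hs, ← Finset.add_sum_erase _ _ ht', xs, xt]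
      have e : ∑ u ∈ (A.erase s).erase t, (if bag u v then deg u (x' u) v else 0) =
          ∑ u ∈ (A.erase s).erase t, if bag u v then deg u (x u) v else 0 :=
        Finset.sum_congr rfl fun u hu => by
          simp only [Finset.mem_erase] at hu
          rw [xu u hu.2.1 hu.1]
      rw [e]
      by_cases htv : bag t v
      · have := (hf v htv).2.1
        simp only [htv, if_true] at h3 ⊢
        omega
      -- A vertex private to `s` is not governed by the merged sum; its only contribution is the
      -- degree in `q`, bounded because `q` is a code.
      · by_cases hsv : bag s v
        · have e0 : ∑ u ∈ (A.erase s).erase t, (if bag u v then deg u (x u) v else 0) = 0 :=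
            Finset.sum_eq_zero fun u hu => by
              simp only [Finset.mem_erase] at hu
              exact if_neg fun huv => htv (hsep v hsv u hu.2.2 hu.2.1 huv)
          have := h.deg_le s q v hq hsv
          simp only [htv, hsv, if_true, if_false, e0]
          omega
        · simp only [htv, hsv, if_false] at h3 ⊢
          omega
  · rintro ⟨c, x, h1, h2⟩
    have h2' : ∀ v, (if bag s v then deg s (x s) v else 0) +
        ((if bag t v then deg t (x t) v else 0) +
        ∑ u ∈ (A.erase s).erase t, if bag u v then deg u (x u) v else 0) ≤ Δ := by
      intro v
      have h3 := h2 v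
      rwa [← Finset.add_sum_erase _ _ hs, ← Finset.add_sum_erase _ _ ht'] at h3
    -- The merged degree is part of a sum bounded by Δ, hence is itself representable by a code.
    obtain ⟨y, hy, hy'⟩ := h.exists_code t c
      (fun v => deg t (x t) v + if bag s v then deg s (x s) v else 0) fun v hv => by
        refine ⟨?_, ?_⟩
        · rw [← (h1 t ht).2.2 v hv]
          exact h.col_lt t _ v (h1 t ht).1 hv
        · have h3 := h2' v
          simp only [hv, if_true] at h3
          omega
    refine ⟨c, Function.update x t y, fun u hu => ?_, fun v => ?_⟩
    · obtain ⟨hus, hu⟩ := Finset.mem_erase.1 hu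
      by_cases hut : u = t
      · subst hut
        rw [Function.update_self]
        refine ⟨hy, (hT' y hy).2 ⟨x u, (h1 u hu).1, (h1 u hu).2.1, x s, (h1 s hs).1,
          (h1 s hs).2.1, fun v hv => ⟨?_, (hy' v hv).2, fun hsv => ?_⟩⟩, fun v hv => (hy' v hv).1⟩
        · rw [(hy' v hv).1, (h1 u hu).2.2 v hv]
        · rw [(hy' v hv).1, (h1 s hs).2.2 v hsv]
      · rw [Function.update_of_ne hut]
        exact ⟨(h1 u hu).1, (hT u hu hus hut _ (h1 u hu).1).2 (h1 u hu).2.1, (h1 u hu).2.2⟩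
    · have h3 := h2' v
      rw [← Finset.add_sum_erase _ _ ht', Function.update_self]
      have e : ∑ u ∈ (A.erase s).erase t,
          (if bag u v then deg u (Function.update x t y u) v else 0) =
          ∑ u ∈ (A.erase s).erase t, if bag u v then deg u (x u) v else 0 :=
        Finset.sum_congr rfl fun u hu => by
          simp only [Finset.mem_erase] at hu
          rw [Function.update_of_ne hu.1]
      rw [e]
      by_cases htv : bag t v
      · have := (hy' v htv).2
        simp only [htv, if_true] at h3 ⊢
        omega
      · simp only [htv, if_false] at h3 ⊢
        omega

theorem extendable_singleton_iff (h : IsCode bag col deg X Δ S) {t : ℕ} {T : ℕ → ℕ → Prop} :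
    Extendable bag col deg Δ S {t} T ↔ ∃ x < S, T t x := by
  constructor
  · rintro ⟨c, x, h1, -⟩
    exact ⟨x t, (h1 t (by simp)).1, (h1 t (by simp)).2.1⟩
  · rintro ⟨x, hx, hT⟩
    refine ⟨col t x, fun _ => x, fun u hu => ?_, fun v => ?_⟩
    · obtain rfl := Finset.mem_singleton.1 hu
      exact ⟨hx, hT, fun _ _ => rfl⟩
    · rw [Finset.sum_singleton]
      split_ifs with hv
      · exact h.deg_le t x v hx hv
      · omega

open Classical in
/-- The number of neighbours of `v` with the color of `v` for which `t` is the first node whose bag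
contains both. -/
noncomputable def firstDegree (bag adj : ℕ → ℕ → Prop) (n : ℕ) (c : ℕ → ℕ) (t v : ℕ) : ℕ :=
  ∑ u ∈ Finset.range n, if bag t u ∧ adj u v ∧ c u = c v ∧
    ∀ t' < t, bag t' u → ¬ bag t' v then 1 else 0

-- The neighbours of `v` with its color are partitioned by the least node whose bag contains both
-- ends, so each edge is counted exactly once.
open Classical in
theorem sum_firstDegree (hadj : ∀ u v, adj u v → ∃ t < N, bag t u ∧ bag t v) (c : ℕ → ℕ) (v : ℕ) :
    (∑ t ∈ Finset.range N, if bag t v then firstDegree bag adj n c t v else 0) =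
      ∑ u ∈ Finset.range n, if adj u v ∧ c u = c v then 1 else 0 := by
  simp only [firstDegree, ← Finset.card_filter]
  have hne : ∀ u, adj u v → {t | bag t u ∧ bag t v}.Nonempty := fun u hu =>
    let ⟨t, _, h⟩ := hadj u v hu
    ⟨t, h⟩
  rw [Finset.card_eq_sum_card_fiberwise (f := fun u => sInf {t | bag t u ∧ bag t v})
    (t := Finset.range N)]
  · refine Finset.sum_congr rfl fun t _ => ?_
    split_ifs with htv
    · congr 1
      ext u
      simp only [Finset.mem_filter]
      constructor
      · rintro ⟨hu, htu, huv, hc, hf⟩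
        refine ⟨⟨hu, huv, hc⟩, le_antisymm (Nat.sInf_le ⟨htu, htv⟩) ?_⟩
        by_contra hlt
        have := Nat.sInf_mem (hne u huv)
        exact hf _ (not_le.1 hlt) this.1 this.2
      · rintro ⟨⟨hu, huv, hc⟩, rfl⟩
        have := Nat.sInf_mem (hne u huv)
        exact ⟨hu, this.1, huv, hc, fun t' ht' h1 h2 => Nat.notMem_of_lt_sInf ht' ⟨h1, h2⟩⟩
    · symm
      rw [Finset.card_eq_zero, Finset.filter_eq_empty_iff]
      intro u hu ht
      simp only [Finset.mem_filter] at hu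
      have := Nat.sInf_mem (hne u hu.2.1)
      rw [ht] at this
      exact htv this.2
  · intro u hu
    simp only [Finset.coe_filter, Set.mem_ofPred_eq] at hu
    obtain ⟨t, ht, h⟩ := hadj u v hu.2.1
    exact Finset.mem_coe.2 (Finset.mem_range.2 ((Nat.sInf_le h).trans_lt ht))

-- Vertex cover by bags makes the common coloring legal on all vertices, and `sum_firstDegree`
-- identifies the total of the local degrees with the true degree.
open Classical in
theorem extendable_range_iff (h : IsCode bag col deg X Δ S)
    (hbag : ∀ t v, bag t v → v < n) (hcov : ∀ v < n, ∃ t < N, bag t v)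
    (hadj : ∀ u v, adj u v → ∃ t < N, bag t u ∧ bag t v) {T : ℕ → ℕ → Prop}
    (hT : ∀ t < N, ∀ x < S, T t x ↔
      ∀ v, bag t v → deg t x v = firstDegree bag adj n (col t x) t v) :
    Extendable bag col deg Δ S (Finset.range N) T ↔
      ∃ c : ℕ → ℕ, (∀ v < n, c v < X) ∧
        ∀ v < n, (∑ u ∈ Finset.range n, if adj u v ∧ c u = c v then 1 else 0) ≤ Δ := by
  -- The degree charged to `t` depends only on the colors inside its bag.
  have key : ∀ t x c, (∀ v, bag t v → col t x v = c v) → ∀ v, bag t v →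
      firstDegree bag adj n (col t x) t v = firstDegree bag adj n c t v := by
    intro t x c hc v hv
    refine Finset.sum_congr rfl fun u _ => ?_
    by_cases hu : bag t u
    · rw [hc u hu, hc v hv]
    · simp [hu]
  constructor
  · rintro ⟨c, x, h1, h2⟩
    refine ⟨c, fun v hv => ?_, fun v hv => ?_⟩
    · obtain ⟨t, ht, htv⟩ := hcov v hv
      have := h1 t (Finset.mem_range.2 ht)
      rw [← this.2.2 v htv]
      exact h.col_lt t _ v this.1 htv
    · rw [← sum_firstDegree hadj]
      refine le_trans (Finset.sum_le_sum fun t ht => ?_) (h2 v)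
      have := h1 t ht
      split_ifs with htv
      · rw [(hT t (Finset.mem_range.1 ht) _ this.1).1 this.2.1 v htv, key t _ c this.2.2 v htv]
      · exact le_rfl
  · rintro ⟨c, h1, h2⟩
    have h3 : ∀ t, t < N → ∀ v, bag t v → firstDegree bag adj n c t v ≤ Δ := by
      intro t ht v hv
      refine le_trans ?_ (h2 v (hbag t v hv))
      rw [← sum_firstDegree hadj]
      have := Finset.single_le_sum (f := fun t => if bag t v then firstDegree bag adj n c t v else 0)
        (fun _ _ => Nat.zero_le _) (Finset.mem_range.2 ht)
      simpa [hv] using this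
    have h4 : ∀ t, ∃ x, t < N → x < S ∧
        ∀ v, bag t v → col t x v = c v ∧ deg t x v = firstDegree bag adj n c t v := by
      intro t
      by_cases ht : t < N
      · obtain ⟨x, hx, hx'⟩ := h.exists_code t c (firstDegree bag adj n c t) fun v hv =>
          ⟨h1 v (hbag t v hv), h3 t ht v hv⟩
        exact ⟨x, fun _ => ⟨hx, hx'⟩⟩
      · exact ⟨0, fun h => absurd h ht⟩
    choose x hx using h4
    refine ⟨c, x, fun t ht => ?_, fun v => ?_⟩
    · rw [Finset.mem_range] at ht
      obtain ⟨hxt, hx'⟩ := hx t ht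
      refine ⟨hxt, (hT t ht _ hxt).2 fun v hv => ?_, fun v hv => (hx' v hv).1⟩
      rw [(hx' v hv).2, key t _ c (fun v hv => (hx' v hv).1) v hv]
    · by_cases hv : v < n
      · refine le_trans (Finset.sum_le_sum fun t ht => ?_) ((sum_firstDegree hadj c v).trans_le
          (h2 v hv))
        split_ifs with htv
        · exact ((hx t (Finset.mem_range.1 ht)).2 v htv).2.le
        · exact le_rfl
      · rw [Finset.sum_eq_zero fun t _ => if_neg fun htv => hv (hbag t v htv)]
        exact Nat.zero_le _

end BagCodes

/-! ### Subtrees -/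

namespace SimpleGraph

variable {ι : Type*} {T : SimpleGraph ι} {A B : Set ι}

theorem IsTree.exists_leaf_of_induce_connected [Finite ι] (hT : T.IsTree)
    (hA : (T.induce A).Connected) (hA' : A.Nontrivial) :
    ∃ s ∈ A, ∃ t ∈ A, T.Adj s t ∧ ∀ t' ∈ A, T.Adj s t' → t' = t := by
  classical
  have := Fintype.ofFinite A
  have : Nontrivial A := hA'.coe_sort
  have hI : (T.induce A).IsTree := ⟨hA, hT.isAcyclic.induce A⟩
  obtain ⟨s, hs⟩ := hI.exists_vert_degree_one_of_nontrivial
  obtain ⟨t, ht, ht'⟩ := degree_eq_one_iff_existsUnique_adj.1 hs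
  exact ⟨s, s.2, t, t.2, ht, fun t' h h' => congrArg Subtype.val (ht' ⟨t', h⟩ h')⟩

theorem Connected.induce_diff_leaf [Finite ι] (hA : (T.induce A).Connected) {s t : ι} (hs : s ∈ A)
    (ht : t ∈ A) (hst : T.Adj s t) (h : ∀ t' ∈ A, T.Adj s t' → t' = t) :
    (T.induce (A \ {s})).Connected := by
  classical
  have := Fintype.ofFinite A
  have hd : (T.induce A).degree ⟨s, hs⟩ = 1 := by
    rw [degree_eq_one_iff_existsUnique_adj]
    exact ⟨⟨t, ht⟩, hst, fun t' h' => Subtype.ext (h t' t'.2 h')⟩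
  have hc := hA.induce_compl_singleton_of_degree_eq_one hd
  let f : (T.induce A).induce {⟨s, hs⟩}ᶜ →g T.induce (A \ {s}) :=
    ⟨fun x => ⟨x.1.1, x.1.2, fun hx => x.2 (Subtype.ext hx)⟩, fun h => h⟩
  refine hc.map f fun x => ⟨⟨⟨x.1, x.2.1⟩, fun hx => x.2.2 (congrArg Subtype.val hx)⟩, rfl⟩

/-- A path inside `A` exists by connectedness, and paths in a forest are unique. -/
theorem IsAcyclic.mem_of_mem_support (hT : T.IsAcyclic) (hA : (T.induce A).Preconnected) {a b : ι}
    (ha : a ∈ A) (hb : b ∈ A) {p : T.Walk a b} (hp : p.IsPath) {u : ι} (hu : u ∈ p.support) :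
    u ∈ A := by
  classical
  obtain ⟨q, hq⟩ := (hA ⟨a, ha⟩ ⟨b, hb⟩).exists_isPath
  obtain ⟨f, hf⟩ : ∃ f : T.induce A →g T, ∀ x, f x = x.1 :=
    ⟨(Embedding.induce A).toHom, fun _ => rfl⟩
  have hf' : Function.Injective f := fun x y hxy => Subtype.ext (by rwa [hf, hf] at hxy)
  have hq' : ((q.map f).copy (hf _) (hf _)).IsPath := by
    rw [Walk.isPath_copy]
    exact hq.map hf'
  have e := congrArg Subtype.val ((hT.subsingleton_path a b).elim ⟨p, hp⟩ ⟨_, hq'⟩)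
  simp only at e
  rw [e, Walk.support_copy, Walk.support_map] at hu
  obtain ⟨v, -, rfl⟩ := List.mem_map.1 hu
  rw [hf]
  exact v.2

/-- The path from the leaf `s` to `u` stays in `A`, so its first step goes to `t`; it also stays in
`B`. With `A` the remaining nodes and `B` the nodes of one vertex, this is the separation property
needed for merging. -/
theorem IsAcyclic.leaf_neighbour_mem (hT : T.IsAcyclic) (hA : (T.induce A).Preconnected)
    (hB : (T.induce B).Preconnected) {s t u : ι} (hs : s ∈ A) (hu : u ∈ A) (hsu : u ≠ s)
    (h : ∀ t' ∈ A, T.Adj s t' → t' = t) (hsB : s ∈ B) (huB : u ∈ B) : t ∈ B := by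
  have hr : T.Reachable s u := (hA ⟨s, hs⟩ ⟨u, hu⟩).map (Embedding.induce (G := T) A).toHom
  obtain ⟨q, hq⟩ := hr.exists_isPath
  cases q with
  | nil => exact absurd rfl hsu
  | @cons _ w _ hw q =>
    have hmem : w ∈ (Walk.cons hw q).support := by simp
    have e := h w (hT.mem_of_mem_support hA hs hu hq hmem) hw
    exact e ▸ hT.mem_of_mem_support hB hsB huB hq hmem

end SimpleGraph

/-! ### Defective colorings with indices in `ℕ` -/

/-- A relation between elements of `Fin a` and `Fin b` as a relation between numbers. -/
def natRel {a b : ℕ} (R : Fin a → Fin b → Prop) (i j : ℕ) : Prop :=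
  ∃ (hi : i < a) (hj : j < b), R ⟨i, hi⟩ ⟨j, hj⟩

open Classical in
theorem isDefectiveColoring_iff {V : Type*} [Fintype V] {G : SimpleGraph V} {χ Δ : ℕ}
    {c : V → Fin χ} :
    IsDefectiveColoring G χ Δ c ↔ ∀ v, (∑ u, if G.Adj u v ∧ c u = c v then 1 else 0) ≤ Δ := by
  have key : ∀ v, (G.induce (c ⁻¹' {c v})).degree ⟨v, rfl⟩ =
      ∑ u, if G.Adj u v ∧ c u = c v then 1 else 0 := by
    intro v
    rw [← Finset.card_filter, ← SimpleGraph.card_neighborFinset_eq_degree,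
      ← Finset.card_map (Function.Embedding.subtype _)]
    congr 1
    ext u
    simp [G.adj_comm u v, and_comm]
  constructor
  · intro h v
    rw [← key]
    exact (SimpleGraph.degree_le_maxDegree _ _).trans (h (c v))
  · intro h i
    refine SimpleGraph.maxDegree_le_of_forall_degree_le _ _ ?_
    rintro ⟨v, rfl⟩
    rw [key]
    exact h v

open Classical in
theorem hasDefectiveColoring_iff {n χ Δ : ℕ} {G : SimpleGraph (Fin n)} :
    HasDefectiveColoring G χ Δ ↔ ∃ c : ℕ → ℕ, (∀ v < n, c v < χ) ∧ ∀ v < n,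
      (∑ u ∈ Finset.range n, if natRel G.Adj u v ∧ c u = c v then 1 else 0) ≤ Δ := by
  simp only [HasDefectiveColoring, isDefectiveColoring_iff]
  constructor
  · rintro ⟨c, hc⟩
    refine ⟨fun v => if h : v < n then c ⟨v, h⟩ else 0, fun v hv => by simp [hv], fun v hv => ?_⟩
    refine le_trans (le_of_eq ?_) (hc ⟨v, hv⟩)
    rw [Finset.sum_range]
    refine Finset.sum_congr rfl fun u _ => ?_
    simp [natRel, hv, Fin.ext_iff]
  · rintro ⟨c, hc, hc'⟩
    refine ⟨fun v => ⟨c v, hc v v.2⟩, fun v => ?_⟩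
    refine le_trans (le_of_eq ?_) (hc' v v.2)
    rw [Finset.sum_range]
    refine Finset.sum_congr rfl fun u _ => ?_
    simp [natRel]

-- With more than n colors all vertices can be colored differently, and no degree exceeds n.
-- Truncating keeps the tables polynomial when χ and Δ are huge but the width is 0.
open Classical in
theorem exists_coloring_truncate_iff {n χ Δ : ℕ} {adj : ℕ → ℕ → Prop} (hadj : ∀ v, ¬ adj v v) :
    (∃ c : ℕ → ℕ, (∀ v < n, c v < χ) ∧ ∀ v < n,
      (∑ u ∈ Finset.range n, if adj u v ∧ c u = c v then 1 else 0) ≤ Δ) ↔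
    ∃ c : ℕ → ℕ, (∀ v < n, c v < if χ < n + 1 then χ else n + 1) ∧ ∀ v < n,
      (∑ u ∈ Finset.range n, if adj u v ∧ c u = c v then 1 else 0) ≤ if Δ < n then Δ else n := by
  have h0 : ∀ v Δ', (∑ u ∈ Finset.range n, if adj u v ∧ u = v then 1 else 0) ≤ Δ' := by
    intro v Δ'
    rw [Finset.sum_eq_zero fun u _ => if_neg ?_]
    · exact Nat.zero_le _
    · rintro ⟨h, rfl⟩
      exact hadj _ h
  have h1 : ∀ (c : ℕ → ℕ) v,
      (∑ u ∈ Finset.range n, if adj u v ∧ c u = c v then 1 else 0) ≤ n := by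
    intro c v
    rw [← Finset.card_filter]
    exact (Finset.card_filter_le _ _).trans (by simp)
  by_cases hχ : χ < n + 1
  · simp only [hχ, if_true]
    refine exists_congr fun c => and_congr_right fun _ => forall₂_congr fun v _ => ?_
    have := h1 c v
    split_ifs <;> omega
  · refine iff_of_true ⟨id, fun v hv => ?_, fun v _ => h0 v _⟩
      ⟨id, fun v hv => ?_, fun v _ => h0 v _⟩
    · simp only [id]; omega
    · simp only [id, hχ, if_false]; omega

/-! ### Reading the input -/

theorem List.getElem?_flatMap_of_length_eq {α β : Type*} {f : α → List β} {b : ℕ}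
    (hf : ∀ a, (f a).length = b) (l : List α) (i j : ℕ) (hj : j < b) :
    (l.flatMap f)[i * b + j]? = l[i]?.bind fun a => (f a)[j]? := by
  induction l generalizing i with
  | nil => simp
  | cons a l ih =>
    cases i with
    | zero =>
      rw [List.flatMap_cons, List.getElem?_append_left (by rw [hf]; omega)]
      simp
    | succ i =>
      rw [List.flatMap_cons, List.getElem?_append_right (by rw [hf, Nat.succ_mul]; omega), hf,
        show (i + 1) * b + j - b = i * b + j by rw [Nat.succ_mul]; omega, ih]
      simp

theorem length_encodeRel {a b : ℕ} (R : Fin a → Fin b → Prop) :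
    (encodeRel R).length = a * b := by
  simp [encodeRel, List.length_flatMap]

theorem getD_encodeRel_ne_zero {a b : ℕ} (R : Fin a → Fin b → Prop) {i j : ℕ} (hi : i < a)
    (hj : j < b) : (encodeRel R).getD (i * b + j) 0 ≠ 0 ↔ natRel R i j := by
  rw [List.getD_eq_getElem?_getD, encodeRel, List.getElem?_flatMap_of_length_eq (b := b)
    (by simp) _ _ _ hj]
  simp [hi, hj, natRel]

theorem natRel_lt {a b i j : ℕ} {R : Fin a → Fin b → Prop} (h : natRel R i j) : i < a ∧ j < b :=
  ⟨h.1, h.2.1⟩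

theorem mul_add_lt_mul {a b i j : ℕ} (hi : i < a) (hj : j < b) : i * b + j < a * b := by
  have := Nat.mul_le_mul_right b (Nat.succ_le_of_lt hi)
  rw [Nat.succ_mul] at this
  omega

/-! ### Values of the formulas on a memory that holds the input. -/

namespace RAM.Algo

variable {n N : ℕ} {G : SimpleGraph (Fin n)} {D : TreeDecomposition G (Fin N)} {χ Δ M : ℕ}
  {m : ℕ → ℕ}

/-- The first `M` cells contain the input. -/
structure HasInput (G : SimpleGraph (Fin n)) (D : TreeDecomposition G (Fin N)) (χ Δ M : ℕ)
    (m : ℕ → ℕ) : Prop where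
  bound : (n + N + 2) * (n + N + 2) ≤ M
  agree : ∀ j < M, m j = (encodeInstance G D χ Δ).getD j 0

theorem HasInput.congr (h : HasInput G D χ Δ M m) {m' : ℕ → ℕ} (h' : ∀ j < M, m' j = m j) :
    HasInput G D χ Δ M m' :=
  ⟨h.bound, fun j hj => (h' j hj).trans (h.agree j hj)⟩

namespace HasInput

variable (h : HasInput G D χ Δ M m)
include h

/-- The whole input lies below address `M`, so an array starting at `M` does not overwrite it. -/
theorem size_le : 4 + n * n + N * N + N * n ≤ M := by
  have := h.bound
  nlinarith

theorem le_bound : n + N + 2 ≤ M := by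
  have := h.bound
  nlinarith

theorem cell_zero : m 0 = χ := by
  have := h.size_le
  rw [h.agree 0 (by omega)]; rfl

theorem cell_one : m 1 = Δ := by
  have := h.size_le
  rw [h.agree 1 (by omega)]; rfl

theorem cell_two : m 2 = n := by
  have := h.size_le
  rw [h.agree 2 (by omega)]; rfl

theorem cell_three : m 3 = N := by
  have := h.size_le
  rw [h.agree 3 (by omega)]; rfl

theorem isAdj_iff (u v : ℕ) : IsAdj M m u v ↔ natRel G.Adj u v := by
  rw [IsAdj, h.cell_two]
  have h1 := h.size_le
  have h2 := h.le_bound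
  suffices hs : ∀ (hu : u < n) (hv : v < n), m (4 + (bmul M u n + v)) ≠ 0 ↔ natRel G.Adj u v by
    constructor
    · rintro ⟨hu, hv, h'⟩
      exact (hs hu hv).1 h'
    · exact fun h' => ⟨h'.1, h'.2.1, (hs h'.1 h'.2.1).2 h'⟩
  intro hu hv
  have h3 := mul_add_lt_mul hu hv
  rw [bmul_eq (by omega), h.agree _ (by omega), encodeInstance,
    List.getD_append _ _ _ _ (by simp [length_encodeRel]; omega),
    List.getD_append _ _ _ _ (by simp [length_encodeRel]; omega),
    List.getD_append_right _ _ _ _ (by simp)]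
  rw [← getD_encodeRel_ne_zero _ hu hv]
  simp

theorem isTree_iff (s t : ℕ) : IsTree M m s t ↔ natRel D.tree.Adj s t := by
  rw [IsTree, h.cell_two, h.cell_three]
  have h1 := h.size_le
  have h2 := h.le_bound
  suffices hs : ∀ (hu : s < N) (hv : t < N),
      m (4 + bmul M n n + (bmul M s N + t)) ≠ 0 ↔ natRel D.tree.Adj s t by
    constructor
    · rintro ⟨hu, hv, h'⟩
      exact (hs hu hv).1 h'
    · exact fun h' => ⟨h'.1, h'.2.1, (hs h'.1 h'.2.1).2 h'⟩
  intro hu hv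
  have h3 := mul_add_lt_mul hu hv
  rw [bmul_eq (by omega), bmul_eq (by omega), h.agree _ (by omega), encodeInstance,
    List.getD_append _ _ _ _ (by simp [length_encodeRel]; omega),
    List.getD_append_right _ _ _ _ (by simp [length_encodeRel]; omega)]
  rw [← getD_encodeRel_ne_zero _ hu hv,
    show 4 + n * n + (s * N + t) - ([χ, Δ, n, N] ++ encodeRel G.Adj).length = s * N + t by
      simp [length_encodeRel]; omega]

theorem isBag_iff (t v : ℕ) : IsBag M m t v ↔ natRel (fun t v => v ∈ D.bag t) t v := by
  rw [IsBag, h.cell_two, h.cell_three]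
  have h1 := h.size_le
  have h2 := h.le_bound
  suffices hs : ∀ (hu : t < N) (hv : v < n), m (4 + bmul M n n + bmul M N N + (bmul M t n + v)) ≠ 0
      ↔ natRel (fun t v => v ∈ D.bag t) t v by
    constructor
    · rintro ⟨hu, hv, h'⟩
      exact (hs hu hv).1 h'
    · exact fun h' => ⟨h'.1, h'.2.1, (hs h'.1 h'.2.1).2 h'⟩
  intro hu hv
  have h3 := mul_add_lt_mul hu hv
  rw [bmul_eq (by omega), bmul_eq (by omega), bmul_eq (by omega), h.agree _ (by omega),
    encodeInstance, List.getD_append_right _ _ _ _ (by simp [length_encodeRel]; omega)]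
  rw [← getD_encodeRel_ne_zero _ hu hv, show 4 + n * n + N * N + (t * n + v) -
    ([χ, Δ, n, N] ++ encodeRel G.Adj ++ encodeRel D.tree.Adj).length = t * n + v by
      simp [length_encodeRel]; omega]

open Classical in
theorem sum_isBag (t : Fin N) :
    (∑ v ∈ Finset.range M, if IsBag M m t v then 1 else 0) = (D.bag t).card := by
  rw [← Finset.card_filter, ← Finset.card_map Fin.valEmbedding]
  congr 1
  ext v
  have := h.le_bound
  simp only [h.isBag_iff, natRel, Finset.mem_filter, Finset.mem_range, Finset.mem_map,
    Fin.valEmbedding_apply]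
  constructor
  · rintro ⟨-, _, hv, hb⟩
    exact ⟨⟨v, hv⟩, hb, rfl⟩
  · rintro ⟨v, hv, rfl⟩
    exact ⟨by omega, t.2, v.2, hv⟩

/-- The maximum is obtained by counting the `j` that are smaller than the size of some bag. -/
theorem maxBag_eq : maxBag M m = Finset.univ.sup fun t => (D.bag t).card := by
  classical
  rw [maxBag, ← Finset.card_filter]
  rw [show (Finset.range M).filter (fun j => ∃ t < M,
    j < ∑ v ∈ Finset.range M, if IsBag M m t v then 1 else 0) =
    Finset.range (Finset.univ.sup fun t => (D.bag t).card) from ?_, Finset.card_range]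
  ext j
  have h2 := h.le_bound
  simp only [Finset.mem_filter, Finset.mem_range, Finset.lt_sup_iff, Finset.mem_univ, true_and]
  constructor
  · rintro ⟨hj, t, -, ht⟩
    by_cases htN : t < N
    · exact ⟨⟨t, htN⟩, by rwa [← h.sum_isBag]⟩
    · rw [Finset.sum_eq_zero fun v _ => if_neg fun hb => htN ((h.isBag_iff t v).1 hb).1] at ht
      omega
  · rintro ⟨t, ht⟩
    have : (D.bag t).card ≤ n := (Finset.card_le_univ _).trans (by simp)
    exact ⟨by omega, t, by omega, by rwa [h.sum_isBag]⟩

theorem maxBag_le : maxBag M m ≤ n := by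
  rw [h.maxBag_eq]
  exact Finset.sup_le fun t _ => (Finset.card_le_univ _).trans (by simp)

theorem colors_eq : colors m = if χ < n + 1 then χ else n + 1 := by
  rw [colors, h.cell_zero, h.cell_two]

theorem degrees_eq : degrees m = (if Δ < n then Δ else n) + 1 := by
  rw [degrees, h.cell_one, h.cell_two]

theorem base_eq : base M m = if χ ≤ 1 then 1 else colors m * degrees m := by
  have h2 := h.le_bound
  rw [base, h.cell_zero, bmul_eq]
  rw [h.degrees_eq]
  split_ifs <;> omega

theorem base_le : base M m ≤ (n + 1) * (n + 1) := by
  rw [h.base_eq]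
  split_ifs
  · nlinarith
  · refine Nat.mul_le_mul ?_ ?_
    · rw [h.colors_eq]; split_ifs <;> omega
    · rw [h.degrees_eq]; split_ifs <;> omega

theorem base_pos : 0 < base M m := by
  rw [h.base_eq]
  split_ifs
  · omega
  · refine Nat.mul_pos ?_ ?_
    · rw [h.colors_eq]; split_ifs <;> omega
    · rw [h.degrees_eq]; split_ifs <;> omega

theorem base_le_bound : base M m ≤ M := by
  have h1 := h.base_le
  have h2 := h.bound
  nlinarith

theorem numCodes_eq : numCodes M m = base M m ^ maxBag M m := by
  have h1 := h.maxBag_le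
  have h2 := h.le_bound
  rw [numCodes, bpow_eq h.base_le_bound (by omega)]

theorem numCodes_pos : 0 < numCodes M m := by
  rw [h.numCodes_eq]
  exact Nat.pow_pos h.base_pos

end HasInput

end RAM.Algo

/-! ### Codes -/

namespace RAM.Algo

variable {n N : ℕ} {G : SimpleGraph (Fin n)} {D : TreeDecomposition G (Fin N)} {χ Δ M : ℕ}
  {m : ℕ → ℕ}

open Classical in
/-- The position of the vertex `v` in the bag of the node `t`. -/
noncomputable def position (M : ℕ) (m : ℕ → ℕ) (t v : ℕ) : ℕ :=
  ∑ u ∈ Finset.range M, if u < v ∧ IsBag M m t u then 1 else 0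

namespace HasInput

variable (h : HasInput G D χ Δ M m)
include h

theorem isBag_lt {t v : ℕ} (hv : IsBag M m t v) : t < N ∧ v < n :=
  natRel_lt ((h.isBag_iff t v).1 hv)

theorem position_lt_position {t v w : ℕ} (hv : IsBag M m t v) (hvw : v < w) :
    position M m t v < position M m t w := by
  classical
  have h1 := h.le_bound
  have h2 := h.isBag_lt hv
  simp only [position, ← Finset.card_filter]
  refine Finset.card_lt_card ((Finset.ssubset_iff_of_subset fun u hu => ?_).2 ⟨v, ?_, ?_⟩)
  · simp only [Finset.mem_filter] at hu ⊢
    exact ⟨hu.1, hu.2.1.trans hvw, hu.2.2⟩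
  · simp only [Finset.mem_filter, Finset.mem_range]
    exact ⟨by omega, hvw, hv⟩
  · simp

theorem position_injective {t v w : ℕ} (hv : IsBag M m t v) (hw : IsBag M m t w)
    (hvw : position M m t v = position M m t w) : v = w := by
  rcases lt_trichotomy v w with hlt | heq | hlt
  · exact absurd hvw (h.position_lt_position hv hlt).ne
  · exact heq
  · exact absurd hvw (h.position_lt_position hw hlt).ne'

theorem position_lt_maxBag {t v : ℕ} (hv : IsBag M m t v) : position M m t v < maxBag M m := by
  classical
  have h1 := h.le_bound
  have h2 := h.isBag_lt hv
  rw [h.maxBag_eq]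
  refine lt_of_lt_of_le ?_
    (Finset.le_sup (f := fun t => (D.bag t).card) (Finset.mem_univ ⟨t, h2.1⟩))
  simp only [← h.sum_isBag, position, ← Finset.card_filter]
  refine Finset.card_lt_card ((Finset.ssubset_iff_of_subset fun u hu => ?_).2 ⟨v, ?_, ?_⟩)
  · simp only [Finset.mem_filter] at hu ⊢
    exact ⟨hu.1, hu.2.2⟩
  · simp only [Finset.mem_filter, Finset.mem_range]
    exact ⟨by omega, hv⟩
  · simp

theorem digit_eq (hS : numCodes M m ≤ M) {t x v : ℕ} (hv : IsBag M m t v)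
    (hx : x < numCodes M m) :
    digit M m t x v = x / base M m ^ position M m t v % base M m := by
  have h1 := h.le_bound
  have h2 := h.maxBag_le
  have h3 := h.position_lt_maxBag hv
  have hle : x / base M m ^ position M m t v ≤ x := Nat.div_le_self _ _
  have hp : bpow M (base M m) (position M m t v) = base M m ^ position M m t v :=
    bpow_eq h.base_le_bound (by omega)
  rw [digit, ← position, hp, bdiv_eq (by omega) (Nat.pow_pos h.base_pos),
    bmod_eq (by omega) h.base_pos]

/-- The digit of `x` at the position of `v` in its bag encodes the pair as color times `degrees m`
plus degree; `hS` makes the bounded divisions exact. -/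
theorem isCode (hχ : 2 ≤ χ) (hS : numCodes M m ≤ M) :
    BagCodes.IsCode (IsBag M m) (col M m) (deg M m) (colors m) (degrees m - 1)
      (numCodes M m) := by
  have hb := h.base_eq
  rw [if_neg (by omega)] at hb
  have hd0 : 0 < degrees m := by rw [degrees]; omega
  have hbM := h.base_le_bound
  have hlt : ∀ {t x v}, IsBag M m t v → x < numCodes M m → digit M m t x v < base M m :=
    fun hv hx => by
      rw [h.digit_eq hS hv hx]
      exact Nat.mod_lt _ h.base_pos
  have hcol : ∀ {t x v}, IsBag M m t v → x < numCodes M m →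
      col M m t x v = digit M m t x v / degrees m := fun hv hx =>
    bdiv_eq ((hlt hv hx).le.trans hbM) hd0
  have hdeg : ∀ {t x v}, IsBag M m t v → x < numCodes M m →
      deg M m t x v = digit M m t x v % degrees m := fun hv hx =>
    bmod_eq ((hlt hv hx).le.trans hbM) hd0
  refine ⟨fun t x v hx hv => ?_, fun t x v hx hv => ?_, fun t f g hfg => ?_⟩
  · rw [hcol hv hx]
    refine Nat.div_lt_of_lt_mul ?_
    rw [mul_comm, ← hb]
    exact hlt hv hx
  · rw [hdeg hv hx]
    have := Nat.mod_lt (digit M m t x v) hd0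
    omega
  · classical
    have hval : ∀ v, IsBag M m t v → f v * degrees m + g v < base M m := fun v hv => by
      rw [hb]
      exact mul_add_lt_mul (hfg v hv).1 (by have := (hfg v hv).2; omega)
    -- Positions beyond the size of the bag receive the digit 0.
    let F : Fin (maxBag M m) → Fin (base M m) := fun j =>
      if hj : ∃ v, IsBag M m t v ∧ position M m t v = j then
        ⟨f hj.choose * degrees m + g hj.choose, hval _ hj.choose_spec.1⟩ else ⟨0, h.base_pos⟩
    have hF : ∀ v (hv : IsBag M m t v), F ⟨position M m t v, h.position_lt_maxBag hv⟩ =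
        ⟨f v * degrees m + g v, hval v hv⟩ := by
      intro v hv
      have hj : ∃ w, IsBag M m t w ∧ position M m t w = position M m t v := ⟨v, hv, rfl⟩
      have e := h.position_injective hj.choose_spec.1 hv hj.choose_spec.2
      simp only [F, dif_pos hj, Fin.mk.injEq]
      rw [e]
    have hx : (finFunctionFinEquiv F : ℕ) < numCodes M m := by
      rw [h.numCodes_eq]
      exact (finFunctionFinEquiv F).2
    refine ⟨finFunctionFinEquiv F, hx, fun v hv => ?_⟩
    have e : digit M m t (finFunctionFinEquiv F) v = f v * degrees m + g v := by
      rw [h.digit_eq hS hv hx]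
      have e1 := congrFun (finFunctionFinEquiv.symm_apply_apply F)
        ⟨position M m t v, h.position_lt_maxBag hv⟩
      rw [hF v hv] at e1
      have e2 := congrArg Fin.val e1
      rwa [finFunctionFinEquiv_symm_apply_val] at e2
    have hg : g v < degrees m := by
      have := (hfg v hv).2
      omega
    rw [hcol hv hx, hdeg hv hx, e]
    constructor
    · rw [mul_comm, Nat.mul_add_div hd0, Nat.div_eq_of_lt hg, add_zero]
    · rw [mul_comm, Nat.mul_add_mod, Nat.mod_eq_of_lt hg]

end HasInput

/-! ### The tables in the memory -/

open Classical in
/-- The tables, computed recursively. -/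
noncomputable def table (M : ℕ) (m : ℕ → ℕ) : ℕ → ℕ → ℕ → ℕ
  | 0 => fun t x => if t < m 3 ∧ x < numCodes M m then initTable M m t x else 0
  | r + 1 => fun t x => if t < m 3 ∧ x < numCodes M m then stepTable M m (table M m r) t x else 0

/-! ### The formulas depend only on the input cells, not on the array. -/

section Agree

variable {m' : ℕ → ℕ} (h : HasInput G D χ Δ M m) (h' : HasInput G D χ Δ M m')
include h h'

theorem isAdj_congr : IsAdj M m' = IsAdj M m :=
  funext₂ fun u v => propext ((h'.isAdj_iff u v).trans (h.isAdj_iff u v).symm)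

theorem isTree_congr : IsTree M m' = IsTree M m :=
  funext₂ fun u v => propext ((h'.isTree_iff u v).trans (h.isTree_iff u v).symm)

theorem isBag_congr : IsBag M m' = IsBag M m :=
  funext₂ fun u v => propext ((h'.isBag_iff u v).trans (h.isBag_iff u v).symm)

theorem degrees_congr : degrees m' = degrees m := by rw [h'.degrees_eq, h.degrees_eq]

theorem base_congr : base M m' = base M m := by
  rw [h'.base_eq, h.base_eq, h'.colors_eq, h.colors_eq, degrees_congr h h']

theorem numCodes_congr : numCodes M m' = numCodes M m := by
  rw [h'.numCodes_eq, h.numCodes_eq, h'.maxBag_eq, h.maxBag_eq, base_congr h h']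

theorem digit_congr : digit M m' = digit M m := by
  funext t x v
  rw [digit, digit, base_congr h h', isBag_congr h h']

theorem col_congr : col M m' = col M m := by
  funext t x v
  rw [col, col, digit_congr h h', degrees_congr h h']

theorem deg_congr : deg M m' = deg M m := by
  funext t x v
  rw [deg, deg, digit_congr h h', degrees_congr h h']

theorem initTable_congr : initTable M m' = initTable M m := by
  funext t x
  unfold initTable InitOk
  rw [isBag_congr h h', isAdj_congr h h', col_congr h h', deg_congr h h']

theorem stepTable_congr : stepTable M m' = stepTable M m := by
  funext T t x
  unfold stepTable IsFirstLeaf IsLeaf Fits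
  rw [isTree_congr h h', isBag_congr h h', col_congr h h', deg_congr h h', numCodes_congr h h']

end Agree

theorem table_eq_zero {r t x : ℕ} (h : ¬(t < m 3 ∧ x < numCodes M m)) : table M m r t x = 0 := by
  cases r <;> simp only [table, if_neg h]

theorem table_zero {t x : ℕ} (ht : t < m 3) (hx : x < numCodes M m) :
    table M m 0 t x = initTable M m t x := by
  simp only [table, ht, hx, and_self, if_true]

theorem table_succ {r t x : ℕ} (ht : t < m 3) (hx : x < numCodes M m) :
    table M m (r + 1) t x = stepTable M m (table M m r) t x := by
  simp only [table, ht, hx, and_self, if_true]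

/-- The number of the cell which holds the entry of a table. -/
theorem HasInput.cell_eq (h : HasInput G D χ Δ M m) {r t x : ℕ}
    (ht : t < N) (hx : x < numCodes M m) (hi : (r * N + t) * numCodes M m + x < M) :
    cell M m ((r * N + t) * numCodes M m + x) = if r = 0 then initTable M m t x
      else stepTable M m (entry M m (r - 1)) t x := by
  have hS := h.numCodes_pos
  have hN : 0 < N := by omega
  have e1 : ((r * N + t) * numCodes M m + x) / numCodes M m = r * N + t := by
    rw [mul_comm, Nat.mul_add_div hS, Nat.div_eq_of_lt hx, add_zero]
  have e2 : ((r * N + t) * numCodes M m + x) % numCodes M m = x := by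
    rw [mul_comm, Nat.mul_add_mod, Nat.mod_eq_of_lt hx]
  have e3 : (r * N + t) / N = r := by
    rw [mul_comm, Nat.mul_add_div hN, Nat.div_eq_of_lt ht, add_zero]
  have e4 : (r * N + t) % N = t := by
    rw [mul_comm, Nat.mul_add_mod, Nat.mod_eq_of_lt ht]
  have hle : r * N + t ≤ (r * N + t) * numCodes M m := Nat.le_mul_of_pos_right _ hS
  rw [cell, h.cell_three, bdiv_eq hi.le hS, bmod_eq hi.le hS, e1, e2,
    bdiv_eq (by omega) hN, bmod_eq (by omega) hN, e3, e4]

/-- Table `r` occupies the array cells from `r * N * numCodes M m` on, so it is complete once `(r +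
1) * N * numCodes M m` cells are filled; what is written after the last table is irrelevant. -/
theorem HasInput.entry_fillMem (h : HasInput G D χ Δ M m)
    (hM : N * N * numCodes M m ≤ M) {r : ℕ} (hr : r < N) {k : ℕ}
    (hk : (r + 1) * N * numCodes M m ≤ k) (hkM : k ≤ M) :
    entry M (fillMem M (cell M) m k) r = table M m r := by
  have hin : ∀ i, HasInput G D χ Δ M (fillMem M (cell M) m i) := fun i =>
    h.congr fun j hj => fillMem_of_lt hj
  have hS := h.numCodes_pos
  have hb := h.le_bound
  have hSM : numCodes M m ≤ M := by
    refine le_trans ?_ hM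
    exact Nat.le_mul_of_pos_left _ (Nat.mul_pos (by omega) (by omega))
  induction r generalizing k with
  | zero =>
    funext t x
    rw [entry, numCodes_congr h (hin k), (hin k).cell_three]
    by_cases htx : t < N ∧ x < numCodes M m
    · have h1 := mul_add_lt_mul (mul_add_lt_mul hr htx.1) htx.2
      have h2 := mul_add_lt_mul (mul_add_lt_mul (Nat.lt_add_one 0) htx.1) htx.2
      have e := (hin ((0 * N + t) * numCodes M m + x)).cell_eq (r := 0) (x := x)
        htx.1 (by rw [numCodes_congr h (hin _)]; exact htx.2)
        (by rw [numCodes_congr h (hin _)]; omega)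
      rw [numCodes_congr h (hin _), if_pos rfl, initTable_congr h (hin _)] at e
      rw [if_pos htx, bmul_eq (by omega), bmul_eq (by omega), fillMem_of_le (by omega) le_rfl, e,
        table_zero (by rw [h.cell_three]; exact htx.1) htx.2]
    · rw [if_neg htx, table_eq_zero (by rwa [h.cell_three])]
  | succ r ih =>
    funext t x
    rw [entry, numCodes_congr h (hin k), (hin k).cell_three]
    by_cases htx : t < N ∧ x < numCodes M m
    · have h1 := mul_add_lt_mul (mul_add_lt_mul hr htx.1) htx.2
      have h2 := mul_add_lt_mul (mul_add_lt_mul (Nat.lt_add_one (r + 1)) htx.1) htx.2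
      -- The previous table is complete before this cell is written, so the induction hypothesis
      -- applies to the memory of that round.
      have h3 : (r + 1) * N * numCodes M m ≤ ((r + 1) * N + t) * numCodes M m + x :=
        (Nat.mul_le_mul_right _ (Nat.le_add_right _ t)).trans (Nat.le_add_right _ x)
      have e := (hin (((r + 1) * N + t) * numCodes M m + x)).cell_eq (r := r + 1) (x := x)
        htx.1 (by rw [numCodes_congr h (hin _)]; exact htx.2)
        (by rw [numCodes_congr h (hin _)]; omega)
      rw [numCodes_congr h (hin _), if_neg (by omega), stepTable_congr h (hin _),
        Nat.add_sub_cancel, ih (by omega) h3 (by omega)] at e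
      rw [if_pos htx, bmul_eq (by omega), bmul_eq (by omega), fillMem_of_le (by omega) le_rfl, e,
        table_succ (by rw [h.cell_three]; exact htx.1) htx.2]
    · rw [if_neg htx, table_eq_zero (by rwa [h.cell_three])]

end RAM.Algo

/-! ### Correctness -/

namespace RAM.Algo

variable {n N : ℕ} {G : SimpleGraph (Fin n)} {D : TreeDecomposition G (Fin N)} {χ Δ M : ℕ}
  {m : ℕ → ℕ}

open BagCodes

namespace HasInput

variable (h : HasInput G D χ Δ M m)
include h

theorem initOk_iff {t x : ℕ} (ht : t < N) : InitOk M m t x ↔ ∀ v, IsBag M m t v →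
    deg M m t x v = firstDegree (IsBag M m) (IsAdj M m) n (col M m t x) t v := by
  classical
  have h2 := h.le_bound
  have key : ∀ v, (∑ u ∈ Finset.range M, if IsBag M m t u ∧ IsAdj M m u v ∧
      col M m t x u = col M m t x v ∧ ∀ t' < M, t' < t → IsBag M m t' u → ¬ IsBag M m t' v
      then 1 else 0) = firstDegree (IsBag M m) (IsAdj M m) n (col M m t x) t v := by
    intro v
    rw [firstDegree]
    symm
    refine (Finset.sum_congr rfl fun u _ => ?_).trans
      (Finset.sum_subset (Finset.range_subset_range.2 (by omega)) fun u _ hu => ?_)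
    · have : (∀ t' < t, IsBag M m t' u → ¬ IsBag M m t' v) ↔
          ∀ t' < M, t' < t → IsBag M m t' u → ¬ IsBag M m t' v :=
        forall_congr' fun t' => ⟨fun h _ h' => h h', fun h h' => h (by omega) h'⟩
      simp only [this]
    · exact if_neg fun hb => hu (Finset.mem_range.2 (h.isBag_lt hb.1).2)
  unfold InitOk
  constructor
  · intro hi v hv
    have := (h.isBag_lt hv).2
    rw [hi v (by omega) hv, key]
  · intro hi v _ hv
    rw [hi v hv, key]

theorem isLeaf_iff {T : ℕ → ℕ → ℕ} {A : Finset (Fin N)} (hT : ∀ t : Fin N, T t 0 = 2 ↔ t ∉ A)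
    (s : ℕ) : IsLeaf M m T s ↔ ∃ s' ∈ A, s'.1 = s ∧ ∃ t ∈ A, D.tree.Adj s' t ∧
      ∀ t' ∈ A, D.tree.Adj s' t' → t' = t := by
  have h2 := h.le_bound
  have hT' : ∀ t : Fin N, T t 0 ≠ 2 ↔ t ∈ A := fun t => by rw [Ne, hT, not_not]
  simp only [IsLeaf, h.isTree_iff]
  constructor
  · rintro ⟨hs, t, -, ⟨ht, hst⟩, huniq⟩
    obtain ⟨hs', ht', hadj⟩ := hst
    refine ⟨⟨s, hs'⟩, (hT' _).1 hs, rfl, ⟨t, ht'⟩, (hT' _).1 ht, hadj, fun u hu hsu => ?_⟩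
    exact Fin.ext (huniq u (by omega) ((hT' _).2 hu) ⟨hs', u.2, hsu⟩)
  · rintro ⟨s, hs, rfl, t, ht, hst, huniq⟩
    refine ⟨(hT' _).2 hs, t, by omega, ⟨(hT' _).2 ht, s.2, t.2, hst⟩, ?_⟩
    rintro u - hu ⟨_, hu', hsu⟩
    exact congrArg Fin.val (huniq ⟨u, hu'⟩ ((hT' _).1 hu) hsu)

/-- A subtree with at least two nodes has a leaf; taking the least one makes the eliminated node
unique. -/
theorem exists_isFirstLeaf {T : ℕ → ℕ → ℕ} {A : Finset (Fin N)}
    (hT : ∀ t : Fin N, T t 0 = 2 ↔ t ∉ A) (hA : (D.tree.induce (A : Set (Fin N))).Connected)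
    (hA' : 1 < A.card) : ∃ s ∈ A, ∃ t ∈ A, D.tree.Adj s t ∧
      (∀ t' ∈ A, D.tree.Adj s t' → t' = t) ∧ ∀ u : ℕ, IsFirstLeaf M m T u ↔ u = s := by
  classical
  have h2 := h.le_bound
  obtain ⟨s, hs, t, ht, hst, huniq⟩ := D.isTree.exists_leaf_of_induce_connected hA
    (Finset.one_lt_card_iff_nontrivial.1 hA')
  have hex : ∃ s, IsLeaf M m T s := ⟨s, (h.isLeaf_iff hT s).2 ⟨s, hs, rfl, t, ht, hst, huniq⟩⟩
  have hlt : ∀ u, IsLeaf M m T u → u < M := fun u hu => by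
    obtain ⟨u, -, rfl, -⟩ := (h.isLeaf_iff hT u).1 hu
    omega
  obtain ⟨s', hs', e, t', ht', hst', huniq'⟩ := (h.isLeaf_iff hT _).1 (Nat.find_spec hex)
  refine ⟨s', hs', t', ht', hst', huniq', fun u => ?_⟩
  rw [e]
  constructor
  · rintro ⟨hu, hu'⟩
    refine le_antisymm ?_ (Nat.find_min' hex hu)
    by_contra hc
    exact hu' _ (hlt _ (Nat.find_spec hex)) (not_le.1 hc) (Nat.find_spec hex)
  · rintro rfl
    exact ⟨Nat.find_spec hex, fun u _ hu => Nat.find_min hex hu⟩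

theorem combines_iff {t s p q x : ℕ} :
    Fits M m t s p q x ↔ Combines (IsBag M m) (col M m) (deg M m) t s p q x := by
  have h2 := h.le_bound
  refine forall_congr' fun v => ⟨fun hf hv => hf ?_ hv, fun hf _ => hf⟩
  have := (h.isBag_lt hv).2
  omega

/-- The invariant of the elimination: `A` is the set of nodes not yet marked by the entry 2. It
stays a subtree, and its tables are solvable iff a coloring exists. -/
theorem exists_alive (hχ : 2 ≤ χ) (hSM : numCodes M m ≤ M) {r : ℕ} (hr : r < N) :
    ∃ A : Finset (Fin N), A.card = N - r ∧ (D.tree.induce (A : Set (Fin N))).Connected ∧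
      (∀ t : Fin N, ∀ x < numCodes M m, table M m r t x = 2 ↔ t ∉ A) ∧
      (Extendable (IsBag M m) (col M m) (deg M m) (degrees m - 1) (numCodes M m)
        (A.map Fin.valEmbedding) (fun t x => table M m r t x = 1) ↔
        HasDefectiveColoring G χ Δ) := by
  classical
  have h2 := h.le_bound
  have hc := h.isCode hχ hSM
  have hS := h.numCodes_pos
  have h3 := h.cell_three
  induction r with
  | zero =>
    refine ⟨Finset.univ, by simp, ?_, fun t x hx => ?_, ?_⟩
    · rw [Finset.coe_univ, (SimpleGraph.induceUnivIso D.tree).connected_iff]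
      exact D.isTree.connected
    · rw [table_zero (by omega) hx, initTable]
      split_ifs <;> simp
    · have e : Finset.univ.map (Fin.valEmbedding (n := N)) = Finset.range N := by
        ext t
        simp
      rw [e, extendable_range_iff (n := n) (adj := IsAdj M m) hc
        (fun t v hv => (h.isBag_lt hv).2), hasDefectiveColoring_iff,
        exists_coloring_truncate_iff (adj := natRel G.Adj), ← h.colors_eq,
        show (if Δ < n then Δ else n) = degrees m - 1 by rw [h.degrees_eq]; rfl]
      · simp only [h.isAdj_iff]
      · rintro v ⟨_, _, hv⟩
        exact G.loopless.irrefl _ hv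
      · intro v hv
        obtain ⟨t, ht⟩ := D.exists_mem_bag ⟨v, hv⟩
        exact ⟨t, t.2, (h.isBag_iff _ _).2 ⟨t.2, hv, ht⟩⟩
      · intro u v huv
        obtain ⟨hu, hv, huv⟩ := (h.isAdj_iff _ _).1 huv
        obtain ⟨t, htu, htv⟩ := D.exists_edge_bag _ _ huv
        exact ⟨t, t.2, (h.isBag_iff _ _).2 ⟨t.2, hu, htu⟩, (h.isBag_iff _ _).2 ⟨t.2, hv, htv⟩⟩
      · intro t ht x hx
        rw [table_zero (by omega) hx, initTable, ← h.initOk_iff ht]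
        split_ifs with hi <;> simp [hi]
  | succ r ih =>
    obtain ⟨A, hcard, hconn, hdead, hiff⟩ := ih (by omega)
    obtain ⟨s, hs, t, ht, hst, huniq, hfirst⟩ :=
      h.exists_isFirstLeaf (T := table M m r) (fun t => hdead t 0 hS) hconn (by omega)
    have htree : ∀ u ∈ A, IsTree M m s u ↔ u = t := by
      intro u hu
      rw [h.isTree_iff]
      constructor
      · rintro ⟨_, _, hsu⟩
        exact huniq u hu hsu
      · rintro rfl
        exact ⟨s.2, u.2, hst⟩
    -- One round in terms of `A`: `s` dies, its neighbour `t` receives the merged table, every other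
    -- node keeps its own.
    have hstep : ∀ (u : Fin N) x, x < numCodes M m → table M m (r + 1) u x =
        if u ∈ A → u = s then 2 else if u = t then
          if ∃ p < numCodes M m, table M m r t p = 1 ∧ ∃ q < numCodes M m, table M m r s q = 1 ∧
            Combines (IsBag M m) (col M m) (deg M m) t s p q x then 1 else 0
        else table M m r u x := by
      intro u x hx
      rw [table_succ (by omega) hx, stepTable]
      have e1 : (table M m r u 0 ≠ 2 → IsFirstLeaf M m (table M m r) u) ↔ (u ∈ A → u = s) := by
        rw [Ne, hdead u 0 hS, not_not, hfirst, Fin.ext_iff]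
      simp only [e1]
      by_cases c : u ∈ A → u = s
      · rw [if_pos c, if_pos c]
      rw [if_neg c, if_neg c]
      have hu : u ∈ A := by
        by_contra hu
        exact c fun h => absurd h hu
      have e2 : (∃ s' < M, IsFirstLeaf M m (table M m r) s' ∧ IsTree M m s' u) ↔ u = t := by
        rw [← htree u hu]
        constructor
        · rintro ⟨s', -, hs', hs'u⟩
          rwa [(hfirst s').1 hs'] at hs'u
        · exact fun hsu => ⟨s, by omega, (hfirst s).2 rfl, hsu⟩
      simp only [e2]
      by_cases hut : u = t
      · subst hut
        rw [if_pos rfl, if_pos rfl]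
        refine if_congr ⟨?_, ?_⟩ rfl rfl
        · rintro ⟨s', -, ⟨hs', -⟩, p, -, ⟨hp, hp'⟩, q, -, ⟨hq, hq'⟩, hf⟩
          rw [(hfirst s').1 hs'] at hq' hf
          exact ⟨p, hp, hp', q, hq, hq', h.combines_iff.1 hf⟩
        · rintro ⟨p, hp, hp', q, hq, hq', hf⟩
          exact ⟨s, by omega, ⟨(hfirst s).2 rfl, (htree u hu).2 rfl⟩, p, by omega, ⟨hp, hp'⟩,
            q, by omega, ⟨hq, hq'⟩, h.combines_iff.2 hf⟩
      · rw [if_neg hut, if_neg hut]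
    refine ⟨A.erase s, ?_, ?_, fun u x hx => ?_, ?_⟩
    · rw [Finset.card_erase_of_mem hs]
      omega
    · rw [Finset.coe_erase]
      exact hconn.induce_diff_leaf hs ht hst huniq
    · rw [hstep u x hx, Finset.mem_erase]
      have hd := hdead u x hx
      by_cases hu : u ∈ A <;> by_cases hus : u = s <;> by_cases hut : u = t <;>
        simp_all
      split_ifs <;> simp
    · rw [← hiff, Finset.map_erase]
      refine extendable_erase_iff (t := t) hc ?_ ?_ ?_ ?_ ?_ ?_
      · exact Finset.mem_map_of_mem _ hs
      · exact Finset.mem_map_of_mem _ ht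
      · simpa [Fin.ext_iff] using hst.ne
      · intro v hsv u hu hus huv
        obtain ⟨u, huA, rfl⟩ := Finset.mem_map.1 hu
        obtain ⟨_, hv, hsv⟩ := (h.isBag_iff _ _).1 hsv
        obtain ⟨_, _, huv⟩ := (h.isBag_iff _ _).1 huv
        refine (h.isBag_iff _ _).2 ⟨t.2, hv, ?_⟩
        exact D.isTree.isAcyclic.leaf_neighbour_mem hconn.preconnected
          (D.connected_nodes ⟨v, hv⟩).preconnected hs huA (fun e => hus (congrArg Fin.val e))
          huniq hsv huv
      · intro u hu hus hut x hx
        obtain ⟨u, huA, rfl⟩ := Finset.mem_map.1 hu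
        have e1 : u ≠ s := fun e => hus (congrArg Fin.val e)
        have e2 : u ≠ t := fun e => hut (congrArg Fin.val e)
        have := hstep u x hx
        rw [if_neg (fun e => e1 (e huA)), if_neg e2] at this
        exact iff_of_eq (congrArg (· = 1) this)
      · intro x hx
        have e1 : t ≠ s := hst.ne'
        have := hstep t x hx
        rw [if_neg (fun e => e1 (e ht)), if_pos rfl] at this
        change table M m (r + 1) t x = 1 ↔ _
        rw [this]
        split_ifs with hif <;> simp [hif]

-- With one color every edge is monochromatic, so only the degrees of `G` matter.
open Classical in
theorem hasDefectiveColoring_iff_of_eq_one (hχ : χ = 1) : HasDefectiveColoring G χ Δ ↔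
    ∀ v < M, (∑ u ∈ Finset.range M, if IsAdj M m u v then 1 else 0) ≤ Δ := by
  have h2 := h.le_bound
  have key : ∀ c : ℕ → ℕ, (∀ v < n, c v < χ) → ∀ v < n,
      (∑ u ∈ Finset.range n, if natRel G.Adj u v ∧ c u = c v then 1 else 0) =
      ∑ u ∈ Finset.range M, if IsAdj M m u v then 1 else 0 := by
    intro c hc v hv
    refine (Finset.sum_congr rfl fun u hu => ?_).trans
      (Finset.sum_subset (Finset.range_subset_range.2 (by omega)) fun u _ hu => ?_)
    · have e : c u = c v := by
        have := hc u (Finset.mem_range.1 hu)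
        have := hc v hv
        omega
      simp only [h.isAdj_iff, e, and_true]
    · exact if_neg fun hb => hu (Finset.mem_range.2 (natRel_lt ((h.isAdj_iff _ _).1 hb)).1)
  rw [hasDefectiveColoring_iff]
  constructor
  · rintro ⟨c, hc, hc'⟩ v -
    by_cases hv : v < n
    · rw [← key c hc v hv]
      exact hc' v hv
    · rw [Finset.sum_eq_zero fun u _ => if_neg fun hb => hv (natRel_lt ((h.isAdj_iff _ _).1 hb)).2]
      exact Nat.zero_le _
  · intro hd
    have h0 : ∀ v < n, (fun _ : ℕ => 0) v < χ := fun _ _ => hχ ▸ Nat.one_pos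
    exact ⟨fun _ => 0, h0, fun v hv => (key _ h0 v hv).trans_le (hd v (by omega))⟩

open Classical in
theorem answer_eq (hM : N * N * numCodes M m ≤ M) (hSM : numCodes M m ≤ M) (hχ : 1 ≤ χ) :
    answer M (fillMem M (cell M) m M) = if HasDefectiveColoring G χ Δ then 1 else 0 := by
  have h2 := h.le_bound
  have hin : HasInput G D χ Δ M (fillMem M (cell M) m M) := h.congr fun j hj => fillMem_of_lt hj
  obtain ⟨t₀⟩ := D.isTree.connected.nonempty
  have hN : N - 1 < N := by have := t₀.2; omega
  rw [answer, hin.cell_zero, hin.cell_one, hin.cell_three, h.entry_fillMem hM hN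
    (by rwa [Nat.sub_add_cancel (by omega)]) le_rfl]
  by_cases hχ1 : χ ≤ 1
  · rw [if_pos hχ1]
    exact if_congr (hin.hasDefectiveColoring_iff_of_eq_one (by omega)).symm rfl rfl
  · rw [if_neg hχ1]
    refine if_congr ?_ rfl rfl
    -- Table `N - 1` has one node alive. Dead nodes hold 2 and entries out of range are 0, so an
    -- entry 1 can only belong to the survivor.
    obtain ⟨A, hcard, -, hdead, hiff⟩ := h.exists_alive (by omega) hSM hN
    obtain ⟨t, rfl⟩ := Finset.card_eq_one.1 (hcard.trans (by omega))
    rw [← hiff, Finset.map_singleton, extendable_singleton_iff (h.isCode (by omega) hSM)]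
    constructor
    · rintro ⟨u, -, x, -, hx⟩
      by_cases hux : u < N ∧ x < numCodes M m
      · have hu := hdead ⟨u, hux.1⟩ x hux.2
        rw [hx] at hu
        have : (⟨u, hux.1⟩ : Fin N) = t := by simpa using hu
        subst this
        exact ⟨x, hux.2, hx⟩
      · rw [table_eq_zero (by rwa [h.cell_three])] at hx
        omega
    · rintro ⟨x, hx, hx'⟩
      have := t.2
      exact ⟨t, by omega, x, by omega, hx'⟩

end HasInput

end RAM.Algo

namespace RAM.Algo

variable {n N : ℕ} {G : SimpleGraph (Fin n)} {D : TreeDecomposition G (Fin N)} {χ Δ M : ℕ}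
  {m : ℕ → ℕ}

/-! ### The number of steps -/

theorem HasInput.numCodes_le (h : HasInput G D χ Δ M m) (hχ : 1 ≤ χ) (hΔ : 1 ≤ Δ) :
    numCodes M m ≤ (n + 1) * (n + 1) * (χ * Δ) ^ (2 * D.width) := by
  have hw : maxBag M m ≤ D.width + 1 := by
    rw [h.maxBag_eq, TreeDecomposition.width]
    omega
  have hb : base M m ≤ (χ * Δ) ^ 2 := by
    rw [h.base_eq]
    split_ifs with hχ1
    · exact Nat.one_le_pow _ _ (Nat.mul_pos hχ hΔ)
    · have h1 : colors m ≤ χ := by rw [h.colors_eq]; split_ifs <;> omega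
      -- Δ + 1 ≤ 2Δ, and the factor 2 is paid for by χΔ ≥ 2.
      have h2 : degrees m ≤ 2 * Δ := by rw [h.degrees_eq]; split_ifs <;> omega
      have h3 : 2 ≤ χ * Δ := (show 2 ≤ χ by omega).trans (Nat.le_mul_of_pos_right _ hΔ)
      calc colors m * degrees m ≤ χ * (2 * Δ) := Nat.mul_le_mul h1 h2
        _ = (χ * Δ) * 2 := by ring
        _ ≤ (χ * Δ) * (χ * Δ) := Nat.mul_le_mul_left _ h3
        _ = (χ * Δ) ^ 2 := by ring
  calc numCodes M m = base M m ^ maxBag M m := h.numCodes_eq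
    _ ≤ base M m ^ (D.width + 1) := Nat.pow_le_pow_right h.base_pos hw
    -- A bag has up to width + 1 vertices; the extra factor is bounded by (n + 1)², the others by
    -- (χΔ)².
    _ = base M m * base M m ^ D.width := by ring
    _ ≤ (n + 1) * (n + 1) * ((χ * Δ) ^ 2) ^ D.width :=
      Nat.mul_le_mul h.base_le (Nat.pow_le_pow_left hb _)
    _ = _ := by rw [← pow_mul]

/-- Since `N` is positive, W ≤ 3(n + N), and 81 (n + N)⁴ generously bounds W²(n + 1)²; 162 doubles
this to absorb the summand 1. The constant dominates the factor `K * 162 ^ K` and the exponents 2K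
and 4K. -/
theorem poly_le_of_le {K W A M w n N : ℕ} (hM : M ≤ W * W * ((n + 1) * (n + 1) * A ^ (2 * w)))
    (hW : W = n + N + 2) (hN : 0 < N) (hA : 0 < A) :
    K * (M + 1) ^ K ≤ (K * 162 ^ K + 4 * K) * A ^ ((K * 162 ^ K + 4 * K) * w) *
      (n + N) ^ (K * 162 ^ K + 4 * K) := by
  have h1 : M + 1 ≤ 162 * (n + N) ^ 4 * A ^ (2 * w) := by
    have hp : 1 ≤ A ^ (2 * w) := Nat.one_le_pow _ _ hA
    have hW3 : W ≤ 3 * (n + N) := by omega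
    have hn : n + 1 ≤ n + N := by omega
    have h2 : W * W * ((n + 1) * (n + 1)) ≤ 81 * (n + N) ^ 4 := by
      calc _ ≤ 3 * (n + N) * (3 * (n + N)) * ((n + N) * (n + N)) :=
            Nat.mul_le_mul (Nat.mul_le_mul hW3 hW3) (Nat.mul_le_mul hn hn)
        _ = 9 * (n + N) ^ 4 := by ring
        _ ≤ _ := Nat.mul_le_mul_right _ (by norm_num)
    have h3 : 1 ≤ (n + N) ^ 4 := Nat.one_le_pow _ _ (by omega)
    have h4 : 1 ≤ (n + N) ^ 4 * A ^ (2 * w) := Nat.mul_pos h3 hp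
    have h5 := Nat.mul_le_mul_right (A ^ (2 * w)) h2
    rw [← mul_assoc] at hM
    nlinarith
  have hC : K * 162 ^ K ≤ K * 162 ^ K + 4 * K := Nat.le_add_right _ _
  have h162 : 1 ≤ 162 ^ K := Nat.one_le_pow _ _ (by norm_num)
  have hK : K ≤ K * 162 ^ K := Nat.le_mul_of_pos_right _ h162
  calc K * (M + 1) ^ K ≤ K * (162 * (n + N) ^ 4 * A ^ (2 * w)) ^ K :=
        Nat.mul_le_mul_left _ (Nat.pow_le_pow_left h1 _)
    _ = K * 162 ^ K * A ^ (2 * K * w) * (n + N) ^ (4 * K) := by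
      rw [mul_pow, mul_pow, ← pow_mul, ← pow_mul]
      ring_nf
    _ ≤ _ := Nat.mul_le_mul (Nat.mul_le_mul hC (Nat.pow_le_pow_right hA
        (Nat.mul_le_mul_right _ (by omega)))) (Nat.pow_le_pow_right (by omega) (by omega))

theorem poly_mono {K K' M M' : ℕ} (hK : K ≤ K') (hM : M ≤ M') :
    K * (M + 1) ^ K ≤ K' * (M' + 1) ^ K' :=
  Nat.mul_le_mul hK ((Nat.pow_le_pow_left (by omega) K).trans
    (Nat.pow_le_pow_right (by omega) hK))

open Classical in
theorem exists_program : ∃ (P : Program) (K : ℕ), ∀ (n N : ℕ) (G : SimpleGraph (Fin n))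
    (D : TreeDecomposition G (Fin N)) (χ Δ : ℕ), 1 ≤ χ → 1 ≤ Δ →
    ∃ M ≤ (n + N + 2) * (n + N + 2) * ((n + 1) * (n + 1) * (χ * Δ) ^ (2 * D.width)),
      Reaches P (initState (encodeInstance G D χ Δ)) (K * (M + 1) ^ K) fun s =>
        s.reg 0 = if HasDefectiveColoring G χ Δ then 1 else 0 := by
  -- Register 0 is still 0 here, which is harmless because no bounded multiplication is involved.
  obtain ⟨p₁, K₁, h₁⟩ := exists_setBound (f := fun a => a.2 2 + a.2 3 + 2)
    (((cell_const 2).add (cell_const 3)).add (.const 2))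
  obtain ⟨p₂, K₂, h₂⟩ := exists_setBound (f := fun a => bmul a.1 a.1 a.1) (.bmul .bound .bound)
  -- The number of codes may exceed the current number of rounds, so it has to be the first factor
  -- of `bmul`.
  obtain ⟨p₃, K₃, h₃⟩ := exists_setBound (f := fun a => bmul a.1 (numCodes a.1 a.2) a.1)
    (.bmul comp_numCodes .bound)
  obtain ⟨p₄, K₄, h₄⟩ := exists_fill (f := cell) (comp_cell (α := Env × ℕ) .snd)
  obtain ⟨p₅, K₅, h₅⟩ := exists_setBound (f := fun a => answer a.1 a.2) comp_answer
  refine ⟨.seq p₁ (.seq p₂ (.seq p₃ (.seq p₄ p₅))), K₁ + K₂ + K₃ + K₄ + K₅,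
    fun n N G D χ Δ hχ hΔ => ?_⟩
  let W := n + N + 2
  let m₀ := (initState (encodeInstance G D χ Δ)).mem
  have hin : ∀ M, W * W ≤ M → HasInput G D χ Δ M m₀ := fun M hM => ⟨hM, fun _ _ => rfl⟩
  have hin₂ := hin _ le_rfl
  let S := numCodes (W * W) m₀
  have hS : 0 < S := hin₂.numCodes_pos
  let M := S * (W * W)
  have hW : W * W ≤ M := Nat.le_mul_of_pos_left _ hS
  have hM := hin M hW
  -- Computed with more rounds, the number of codes is the same, so the final bound fits the tables.
  have hSM : numCodes M m₀ = S := by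
    rw [hM.numCodes_eq, hM.maxBag_eq, hM.base_eq, ← hin₂.base_eq, ← hin₂.maxBag_eq,
      ← hin₂.numCodes_eq]
  have hWW : 0 < W * W := by positivity
  have hWM : W ≤ M := (Nat.le_mul_of_pos_left W (by positivity)).trans hW
  refine ⟨M, ?_, ?_⟩
  · exact (Nat.mul_le_mul_right _ (hin₂.numCodes_le hχ hΔ)).trans_eq (mul_comm _ _)
  refine Reaches.mono (T := K₁ * (M + 1) ^ K₁ + (K₂ * (M + 1) ^ K₂ + (K₃ * (M + 1) ^ K₃ +
    (K₄ * (M + 1) ^ K₄ + K₅ * (M + 1) ^ K₅)))) (((h₁ _).mono (poly_mono le_rfl (Nat.zero_le _))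
    fun _ h => h).seq fun s₁ hs₁ => ?_) ?_ fun _ h => h
  · have e₁ : s₁.reg 0 = W := by
      rw [hs₁.1]
      change m₀ 2 + m₀ 3 + 2 = W
      rw [hM.cell_two, hM.cell_three]
    have e₁' : s₁.mem = m₀ := hs₁.2
    refine ((h₂ s₁).mono (poly_mono le_rfl (by rwa [e₁])) fun _ h => h).seq fun s₂ hs₂ => ?_
    have e₂ : s₂.reg 0 = W * W := by rw [hs₂.1, e₁, bmul_eq le_rfl]
    have e₂' : s₂.mem = m₀ := hs₂.2.trans e₁'
    refine ((h₃ s₂).mono (poly_mono le_rfl (by rwa [e₂])) fun _ h => h).seq fun s₃ hs₃ => ?_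
    have e₃ : s₃.reg 0 = M := by rw [hs₃.1, e₂, e₂', bmul_eq le_rfl]
    have e₃' : s₃.mem = m₀ := hs₃.2.trans e₂'
    refine ((h₄ s₃).mono (poly_mono le_rfl (by rw [e₃])) fun _ h => h).seq fun s₄ hs₄ => ?_
    rw [e₃, e₃'] at hs₄
    refine (h₅ s₄).mono (poly_mono le_rfl (by rw [hs₄.1])) fun s₅ hs₅ => ?_
    rw [hs₅.1, hs₄.1, hs₄.2]
    refine hM.answer_eq ?_ ?_ hχ
    · rw [hSM, mul_comm]
      exact Nat.mul_le_mul_left _ (Nat.mul_le_mul (by omega) (by omega))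
    · rw [hSM]
      exact Nat.le_mul_of_pos_right _ hWW
  · have hK : ∀ K, K ≤ K₁ + K₂ + K₃ + K₄ + K₅ → K * (M + 1) ^ K ≤
        K * (M + 1) ^ (K₁ + K₂ + K₃ + K₄ + K₅) := fun K h =>
      Nat.mul_le_mul_left _ (Nat.pow_le_pow_right (by omega) h)
    have i₁ := hK K₁ (by omega)
    have i₂ := hK K₂ (by omega)
    have i₃ := hK K₃ (by omega)
    have i₄ := hK K₄ (by omega)
    have i₅ := hK K₅ (by omega)
    simp only [add_mul]
    omega

end RAM.Algo

theorem mainTheorem9 :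
    ∃ (P : RAM.Program) (C : ℕ),
      ∀ (n N : ℕ) (G : SimpleGraph (Fin n)) (D : TreeDecomposition G (Fin N)) (χ Δ : ℕ),
        1 ≤ χ → 1 ≤ Δ →
        ∃ (t : ℕ) (s : RAM.State),
          RAM.Runs P (RAM.initState (encodeInstance G D χ Δ)) t s ∧
          t ≤ C * (χ * Δ) ^ (C * D.width) * (n + N) ^ C ∧
          (HasDefectiveColoring G χ Δ → s.reg 0 = 1) ∧
          (¬ HasDefectiveColoring G χ Δ → s.reg 0 = 0) := by
  obtain ⟨P, K, h⟩ := RAM.Algo.exists_program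
  refine ⟨P, K * 162 ^ K + 4 * K, fun n N G D χ Δ hχ hΔ => ?_⟩
  obtain ⟨M, hM, t, s, hrun, ht, hs⟩ := h n N G D χ Δ hχ hΔ
  -- A tree is nonempty, so `N` is positive, even for a graph without vertices.
  obtain ⟨t₀⟩ := D.isTree.connected.nonempty
  refine ⟨t, s, hrun, ht.trans (RAM.Algo.poly_le_of_le hM rfl (by have := t₀.2; omega)
    (Nat.mul_pos hχ hΔ)), fun hc => ?_, fun hc => ?_⟩
  · rw [hs, if_pos hc]
  · rw [hs, if_neg hc]
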